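/- Let $0<d<1/2$, let $p,q\ge 0$ be integers, and let $A(z)=z^p+a_1z^{p-1}+\dots+a_p$, $B(z)=z^q+b_1z^{q-1}+\dots+b_q$ be real polynomials that do not vanish on $\{z\in\mathbb C:|z|\ge 1\}$. Let $(\varepsilon_n)_{n\in\mathbb Z}$ be a white noise (square integrable, centred, pairwise uncorrelated, with common variance $>0$), and let $X=(X_n)_{n\ge 0}$ be the FARIMA$(p,d,q)$ process $$X_n=\sum_{j\ge 0}\psi_j\,\varepsilon_{n-j}\ \text{ (convergence in } L^2),\qquad \sum_{j\ge 0}\psi_jz^j=\frac{1+b_1z+\dots+b_qz^q}{1+a_1z+\dots+a_pz^p}\,(1-z)^{-d}.$$ Let $(T_n)_{n\ge 0}$ be a random walk independent of $X$, with $T_0=0$ and independent identically distributed integer steps that are almost surely $\ge 1$, and suppose that for some $\gamma>1$ and $c>0$ $$S(j)=P(T_1=j)\sim c\,j^{-\gamma}\qquad (j\to\infty).$$ Put $Y_n=X_{T_n}$. For a second order stationary process $Z=(Z_n)_{n\ge 0}$ write $\sigma_Z(h)=\mathrm{Cov}(Z_0,Z_h)$. Say that $Z$ has long memory if $\sum_{h\ge0}|\sigma_Z(h)|=\infty$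 and short memory if $\sum_{h\ge0}|\sigma_Z(h)|<\infty$, and that $Z$ has memory parameter $\delta$ if $|\sigma_Z(h)|=h^{2\delta-1+o(1)}$ as $h\to\infty$, that is, if for every $\varepsilon>0$, $h^{2\delta-1-\varepsilon}\le|\sigma_Z(h)|\le h^{2\delta-1+\varepsilon}$ for all sufficiently large $h$. Then $X$ and $Y$ are second order stationary, $X$ has long memory with memory parameter $d$, and: (i) if $\gamma>2$, there is a constant $C>0$ with $\sigma_Y(h)\sim C\,h^{2d-1}$ as $h\to\infty$; (ii) if $\gamma\le 2$, there are constants $C_1,C_2>0$ such that $\sigma_Y(h)\le C_2\,h^{(2d-1)/(\gamma-1)}$ for all $h\ge 1$ and, for every $\varepsilon>0$, $C_1\,h^{(2d-1)/(\gamma-1)-\varepsilon}\le\sigma_Y(h)$ for all sufficiently large $h$ (how large may depend on $\varepsilon$). Consequently: - if $\gamma\ge 2$, then $Y$ has long memory with the same memory parameter $d$ as $X$; - if $2(1-d)\le\gamma<2$, then $Y$ has long memory with the reduced memory parameter $d'=\frac12\Big(1-\frac{1-2d}{\gamma-1}\Big)$, and $0\le d'<d$; - if $1<\gamma<2(1-d)$,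 then $Y$ has short memory. -/

import Mathlib

open MeasureTheory ProbabilityTheory Filter Topology Asymptotics

noncomputable section

namespace RandomSampling

variable {Ω : Type*} [MeasurableSpace Ω]

/-- A second order stationary process with time set `ℕ`. -/
structure IsSecondOrderStationary (X : ℕ → Ω → ℝ) (μ : Measure Ω) : Prop where
  memLp : ∀ n, MemLp (X n) 2 μ
  mean : ∀ n, ∫ ω, X n ω ∂μ = ∫ ω, X 0 ω ∂μ
  cov : ∀ n h, cov[X n, X (n + h); μ] = cov[X 0, X h; μ]

/-- The covariance sequence `σ_X(h)` of a second order stationary process. -/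
def autocov (X : ℕ → Ω → ℝ) (μ : Measure Ω) (h : ℕ) : ℝ := cov[X 0, X h; μ]

/-- Long memory: the covariance sequence is not absolutely summable. -/
def HasLongMemory (X : ℕ → Ω → ℝ) (μ : Measure Ω) : Prop :=
  ¬ Summable fun h => |autocov X μ h|

/-- Short memory: the covariance sequence is absolutely summable. -/
def HasShortMemory (X : ℕ → Ω → ℝ) (μ : Measure Ω) : Prop :=
  Summable fun h => |autocov X μ h|

/-- The memory parameter is `δ` when `|σ_X(h)| = h ^ (2 δ - 1 + o(1))` as `h → ∞`. -/
def HasMemoryParameter (X : ℕ → Ω → ℝ) (μ : Measure Ω) (δ : ℝ) : Prop :=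
  ∀ ε : ℝ, 0 < ε → ∀ᶠ h : ℕ in atTop,
    (h : ℝ) ^ (2 * δ - 1 - ε) ≤ |autocov X μ h| ∧
      |autocov X μ h| ≤ (h : ℝ) ^ (2 * δ - 1 + ε)

/-- A (weak, nondegenerate) white noise indexed by `ℤ`. -/
structure IsWhiteNoise (ε : ℤ → Ω → ℝ) (μ : Measure Ω) : Prop where
  memLp : ∀ n, MemLp (ε n) 2 μ
  mean : ∀ n, ∫ ω, ε n ω ∂μ = 0
  uncorrelated : ∀ m n, m ≠ n → cov[ε m, ε n; μ] = 0
  variance : ∃ v : ℝ, 0 < v ∧ ∀ n, Var[ε n; μ] = v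

/-- The power series of `(1 - z) ^ (-d)`, whose `j`-th coefficient is
`d (d + 1) ⋯ (d + j - 1) / j!`. -/
def fracSeries (d : ℝ) : PowerSeries ℝ :=
  PowerSeries.mk fun j => (ascPochhammer ℝ j).eval d / (j.factorial : ℝ)

/-- The power series in the back-shift variable of the filter `B A⁻¹ (1 - L) ^ (-d)`.
For `A = z ^ p + a₁ z ^ (p - 1) + ⋯ + a_p`, the autoregressive operator is
`1 + a₁ L + ⋯ + a_p L ^ p`, which is `A.reverse`; likewise for `B`. -/
def farimaSeries (A B : Polynomial ℝ) (d : ℝ) : PowerSeries ℝ :=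
  (B.reverse : PowerSeries ℝ) * (A.reverse : PowerSeries ℝ)⁻¹ * fracSeries d

/-- `X` is a FARIMA(`p`, `d`, `q`) process: `X_n = ∑ j, ψ_j ε_{n-j}` with convergence in `L²`,
where `ε` is a white noise and `∑ j, ψ_j z ^ j` is the power series of
`B A⁻¹ (1 - z) ^ (-d)`. -/
def IsFARIMA (p : ℕ) (d : ℝ) (q : ℕ) (X : ℕ → Ω → ℝ) (μ : Measure Ω) : Prop :=
  ∃ (A B : Polynomial ℝ) (ε : ℤ → Ω → ℝ),
    A.Monic ∧ A.natDegree = p ∧ (∀ z : ℂ, 1 ≤ ‖z‖ → Polynomial.aeval z A ≠ 0) ∧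
    B.Monic ∧ B.natDegree = q ∧ (∀ z : ℂ, 1 ≤ ‖z‖ → Polynomial.aeval z B ≠ 0) ∧
    IsWhiteNoise ε μ ∧
    ∀ n : ℕ, Tendsto
      (fun N : ℕ => eLpNorm (fun ω => X n ω -
        ∑ j ∈ Finset.range N,
          PowerSeries.coeff j (farimaSeries A B d) * ε ((n : ℤ) - (j : ℤ)) ω) 2 μ)
      atTop (𝓝 0)

/-- `T` is a random walk on the integers with `T_0 = 0` and independent identically distributed
steps `T_{j+1} - T_j`, almost surely at least one. -/
structure IsSamplingWalk (T : ℕ → Ω → ℕ) (μ : Measure Ω) : Prop where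
  measurable : ∀ n, Measurable (T n)
  zero : ∀ ω, T 0 ω = 0
  step_pos : ∀ n, ∀ᵐ ω ∂μ, T n ω < T (n + 1) ω
  indep : iIndepFun (fun (n : ℕ) (ω : Ω) => (T (n + 1) ω : ℤ) - (T n ω : ℤ)) μ
  identDistrib : ∀ n : ℕ, IdentDistrib (fun ω => (T (n + 1) ω : ℤ) - (T n ω : ℤ))
    (fun ω => (T 1 ω : ℤ) - (T 0 ω : ℤ)) μ μ

/-- The sampled process `Y_n = X_{T_n}`. -/
def sampled (X : ℕ → Ω → ℝ) (T : ℕ → Ω → ℕ) (n : ℕ) (ω : Ω) : ℝ := X (T n ω) ω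

end RandomSampling

end

/-! Conditioning on the independent walk gives `σ_Y(h) = E σ_X(T_h)`, so two things matter: how
`σ_X` decays and how fast `T_h` grows.

For `X`, the series of `B/A` decays geometrically and has non-zero sum `B(1)/A(1)`, while the
coefficients of `(1 - z)^(-d)` behave like `j^(d-1)/Γ(d)` by Euler's limit formula. Hence `ψ_j ~ κ
j^(d-1)` with `κ ≠ 0` (`exists_tendsto_coeff_farimaSeries`). The covariance `v ∑ ψ_j ψ_{j+h}` is
then a Riemann sum, and `σ_X(h) ~ C h^(2d-1)` with `C > 0` (`tendsto_tsum_mul_shift`,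
`IsFARIMA.secondOrder`).

With `b = 1 - 2d`, it remains to estimate `E T_h^(-b)`. If `γ > 2`, steps are integrable, `T_h/h`
converges to a positive constant, and dominated convergence keeps the exponent. If `γ ≤ 2`, `T_h`
grows roughly like `h^(1/(γ-1))`, which is made quantitative through the Laplace transform `φ` of a
step, using `E exp(-s T_h) = φ(s)^h`. The lower tail bound on `S` gives `φ(s) ≤ exp(-c' s^(γ-1))`,
and the Gamma integral for `T_h^(-b)` turns this into an upper bound. The upper tail bound gives `1
- φ(s) ≤ C s^a` for `a ≤ γ - 1`, `a < 1`; then `T^(-b) ≥ s^b exp(-s T)` with `s` of order `h^(-1/a)`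
gives a lower bound. The choice `a = γ - 1` is allowed only when `γ < 2`; at `γ = 2` an `ε` is lost.
-/

namespace RandomSampling

/-! ### Power series with weighted summable coefficients, and the ARMA filter -/

section WeightedSummable

variable {𝕜 : Type*} [NormedField 𝕜]

/-- The coefficients of a power series are summable against the weight `k + 1`. -/
def WeightedSummable (F : PowerSeries 𝕜) : Prop :=
  Summable fun k : ℕ => ‖PowerSeries.coeff k F‖ * ((k : ℝ) + 1)

lemma WeightedSummable.summable_norm {F : PowerSeries 𝕜} (hF : WeightedSummable F) :
    Summable fun k : ℕ => ‖PowerSeries.coeff k F‖ :=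
  Summable.of_nonneg_of_le (fun _ => norm_nonneg _)
    (fun k => le_mul_of_one_le_right (norm_nonneg _) (by simp)) hF

/-- The weight is submultiplicative: `i + j + 1 ≤ (i + 1)(j + 1)`. -/
lemma WeightedSummable.mul {F G : PowerSeries 𝕜} (hF : WeightedSummable F)
    (hG : WeightedSummable G) : WeightedSummable (F * G) := by
  have h := summable_norm_sum_mul_antidiagonal_of_summable_norm hF.norm hG.norm
  refine Summable.of_nonneg_of_le (fun _ => by positivity) (fun n => ?_) h
  rw [PowerSeries.coeff_mul, Real.norm_of_nonneg (Finset.sum_nonneg fun _ _ => by positivity)]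
  calc ‖∑ p ∈ Finset.HasAntidiagonal.antidiagonal n, PowerSeries.coeff p.1 F * PowerSeries.coeff p.2 G‖
        * ((n : ℝ) + 1)
      ≤ (∑ p ∈ Finset.HasAntidiagonal.antidiagonal n, ‖PowerSeries.coeff p.1 F * PowerSeries.coeff p.2 G‖)
        * ((n : ℝ) + 1) := by gcongr; exact norm_sum_le _ _
    _ ≤ _ := by
      rw [Finset.sum_mul]
      refine Finset.sum_le_sum fun p hp => ?_
      have hn : (n : ℝ) = p.1 + p.2 := by
        rw [← Finset.HasAntidiagonal.mem_antidiagonal.1 hp]; push_cast; ring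
      have h1 : (n : ℝ) + 1 ≤ ((p.1 : ℝ) + 1) * ((p.2 : ℝ) + 1) := by
        rw [hn]; nlinarith [Nat.cast_nonneg (α := ℝ) p.1, Nat.cast_nonneg (α := ℝ) p.2,
          mul_nonneg (Nat.cast_nonneg (α := ℝ) p.1) (Nat.cast_nonneg (α := ℝ) p.2)]
      rw [norm_mul]
      calc _ ≤ ‖PowerSeries.coeff p.1 F‖ * ‖PowerSeries.coeff p.2 G‖ *
            (((p.1 : ℝ) + 1) * ((p.2 : ℝ) + 1)) := by gcongr
        _ = _ := by ring

lemma weightedSummable_coe (P : Polynomial 𝕜) : WeightedSummable (P : PowerSeries 𝕜) := by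
  refine summable_of_ne_finset_zero (s := P.support) fun k hk => ?_
  simp [Polynomial.coeff_coe, Polynomial.notMem_support_iff.1 hk]

lemma tsum_coeff_coe (P : Polynomial 𝕜) :
    ∑' k, PowerSeries.coeff k (P : PowerSeries 𝕜) = P.eval 1 := by
  rw [Polynomial.eval_eq_sum, tsum_eq_sum (s := P.support)]
  · simp [Polynomial.sum]
  · intro k hk
    simp [Polynomial.coeff_coe, Polynomial.notMem_support_iff.1 hk]

lemma WeightedSummable.tsum_coeff_mul [CompleteSpace 𝕜] {F G : PowerSeries 𝕜}
    (hF : WeightedSummable F) (hG : WeightedSummable G) :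
    ∑' k, PowerSeries.coeff k (F * G) =
      (∑' k, PowerSeries.coeff k F) * ∑' k, PowerSeries.coeff k G := by
  rw [tsum_mul_tsum_eq_tsum_sum_antidiagonal_of_summable_norm hF.summable_norm hG.summable_norm]
  simp only [PowerSeries.coeff_mul]

lemma weightedSummable_mk_pow {a : 𝕜} (ha : ‖a‖ < 1) :
    WeightedSummable (PowerSeries.mk fun k => a ^ k) := by
  have h1 := summable_pow_mul_geometric_of_norm_lt_one (R := ℝ) 1 (r := ‖a‖) (by simpa using ha)
  have h2 := summable_geometric_of_lt_one (norm_nonneg a) ha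
  refine (h1.add h2).congr fun k => ?_
  simp only [PowerSeries.coeff_mk, norm_pow, pow_one]
  ring

lemma reverse_X_sub_C_mul_mk_pow (a : 𝕜) :
    ((Polynomial.X - Polynomial.C a).reverse : PowerSeries 𝕜) * (PowerSeries.mk fun k => a ^ k)
      = 1 := by
  have h : (Polynomial.X - Polynomial.C a).reverse = 1 - Polynomial.C a * Polynomial.X := by
    have h1 : (Polynomial.X : Polynomial 𝕜).reverse = 1 := by
      rw [← one_mul Polynomial.X, Polynomial.reverse_mul_X, ← Polynomial.C_1,
        Polynomial.reverse_C]
    rw [sub_eq_add_neg, ← Polynomial.C_neg, Polynomial.reverse_add_C, h1,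
      Polynomial.natDegree_X]
    simp [sub_eq_add_neg]
  rw [h]
  ext n
  rw [Polynomial.coe_sub, sub_mul, Polynomial.coe_one, one_mul, Polynomial.coe_mul,
    Polynomial.coe_C, Polynomial.coe_X, mul_assoc, map_sub, PowerSeries.coeff_C_mul]
  cases n with
  | zero => simp
  | succ n => simp [PowerSeries.coeff_succ_X_mul, PowerSeries.coeff_one, pow_succ']

/-- Each factor `X - a` reverses to `1 - a X`, whose inverse is a geometric series; weighted
summability survives products. -/
lemma exists_weightedSummable_reverse_mul_eq_one (s : Multiset 𝕜) (hs : ∀ a ∈ s, ‖a‖ < 1) :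
    ∃ G : PowerSeries 𝕜, WeightedSummable G ∧
      ((s.map fun a => Polynomial.X - Polynomial.C a).prod.reverse : PowerSeries 𝕜) * G = 1 := by
  induction s using Multiset.induction with
  | empty =>
    refine ⟨1, by simpa using weightedSummable_coe (1 : Polynomial 𝕜), ?_⟩
    rw [Multiset.map_zero, Multiset.prod_zero, ← Polynomial.C_1, Polynomial.reverse_C]
    simp
  | cons a s ih =>
    obtain ⟨G, hG, h⟩ := ih fun b hb => hs b (Multiset.mem_cons_of_mem hb)
    refine ⟨(PowerSeries.mk fun k => a ^ k) * G,
      (weightedSummable_mk_pow (hs a (Multiset.mem_cons_self a s))).mul hG, ?_⟩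
    rw [Multiset.map_cons, Multiset.prod_cons, Polynomial.reverse_mul_of_domain,
      Polynomial.coe_mul, mul_mul_mul_comm, h, reverse_X_sub_C_mul_mk_pow, one_mul]

end WeightedSummable

/-- Over `ℂ` the polynomial splits with all roots in the open unit disc, so the factorwise inverse
applies; passing to `ℂ` preserves norms of coefficients. -/
lemma weightedSummable_inv_reverse {A : Polynomial ℝ} (hA : A.Monic)
    (hroots : ∀ z : ℂ, 1 ≤ ‖z‖ → Polynomial.aeval z A ≠ 0) :
    WeightedSummable (A.reverse : PowerSeries ℝ)⁻¹ := by
  set Ac : Polynomial ℂ := A.map (algebraMap ℝ ℂ) with hAc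
  have hmon : Ac.Monic := hA.map _
  have hrev : Ac.reverse = A.reverse.map (algebraMap ℝ ℂ) := by
    rw [Polynomial.reverse, Polynomial.reverse, ← Polynomial.reflect_map, hAc,
      hA.natDegree_map]
  obtain ⟨G, hG, h⟩ := exists_weightedSummable_reverse_mul_eq_one Ac.roots (by
    intro a ha
    by_contra hcon
    refine hroots a (not_lt.1 hcon) ?_
    have := (Polynomial.mem_roots'.1 ha).2
    rwa [Polynomial.IsRoot, hAc, Polynomial.eval_map_algebraMap] at this)
  rw [← (IsAlgClosed.splits Ac).eq_prod_roots_of_monic hmon, hrev,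
    Polynomial.polynomial_map_coe] at h
  have h0 : (A.reverse : PowerSeries ℝ) * (A.reverse : PowerSeries ℝ)⁻¹ = 1 := by
    refine PowerSeries.mul_inv_cancel _ ?_
    rw [← PowerSeries.coeff_zero_eq_constantCoeff_apply, Polynomial.coeff_coe,
      Polynomial.coeff_zero_reverse, hA.leadingCoeff]
    exact one_ne_zero
  have h1 := congrArg (PowerSeries.map (algebraMap ℝ ℂ)) h0
  rw [map_mul, map_one] at h1
  -- Inverses are unique, so the inverse built over `ℂ` is the image of the real one.
  have h2 : PowerSeries.map (algebraMap ℝ ℂ) (A.reverse : PowerSeries ℝ)⁻¹ = G := by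
    rw [← mul_one (PowerSeries.map _ _), ← h, ← mul_assoc, mul_comm (PowerSeries.map _ _), h1,
      one_mul]
  refine Summable.congr hG fun k => ?_
  rw [← h2, PowerSeries.coeff_map]
  simp

/-- A polynomial and its reverse agree at `1`, which lies in the region free of zeros. -/
lemma eval_one_reverse_ne_zero {A : Polynomial ℝ}
    (hroots : ∀ z : ℂ, 1 ≤ ‖z‖ → Polynomial.aeval z A ≠ 0) : A.reverse.eval 1 ≠ 0 := by
  intro h
  let _ : Invertible (1 : ℝ) := invertibleOne
  have h1 := Polynomial.eval₂_reverse_mul_pow (RingHom.id ℝ) (1 : ℝ) A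
  simp only [invOf_one, one_pow, mul_one, Polynomial.eval₂_id, h] at h1
  refine hroots 1 (by simp) ?_
  have h2 := Polynomial.aeval_algebraMap_apply ℂ (1 : ℝ) A
  simp only [map_one, Polynomial.aeval_def, Algebra.algebraMap_self, Polynomial.eval₂_id,
    ← h1] at h2
  simpa [Polynomial.aeval_def] using h2

/-- The filter `B A⁻¹` has summable coefficients with non-zero sum. -/
lemma weightedSummable_arma {A B : Polynomial ℝ} (hA : A.Monic)
    (hAr : ∀ z : ℂ, 1 ≤ ‖z‖ → Polynomial.aeval z A ≠ 0)
    (hBr : ∀ z : ℂ, 1 ≤ ‖z‖ → Polynomial.aeval z B ≠ 0) :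
    WeightedSummable ((B.reverse : PowerSeries ℝ) * (A.reverse : PowerSeries ℝ)⁻¹) ∧
      ∑' k, PowerSeries.coeff k ((B.reverse : PowerSeries ℝ) * (A.reverse : PowerSeries ℝ)⁻¹)
        ≠ 0 := by
  have hAi := weightedSummable_inv_reverse hA hAr
  have hW := (weightedSummable_coe B.reverse).mul hAi
  refine ⟨hW, fun h => eval_one_reverse_ne_zero hBr ?_⟩
  have h0 : (A.reverse : PowerSeries ℝ)⁻¹ * (A.reverse : PowerSeries ℝ) = 1 := by
    refine PowerSeries.inv_mul_cancel _ ?_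
    rw [← PowerSeries.coeff_zero_eq_constantCoeff_apply, Polynomial.coeff_coe,
      Polynomial.coeff_zero_reverse, hA.leadingCoeff]
    exact one_ne_zero
  -- Summing coefficients is multiplicative, so multiplying back by the reverse of `A` would make
  -- the value of `B.reverse` at `1` vanish.
  have h1 := hW.tsum_coeff_mul (weightedSummable_coe A.reverse)
  rwa [h, zero_mul, mul_assoc, h0, mul_one, tsum_coeff_coe] at h1

/-! ### Regular decay of the FARIMA coefficients -/

/-- The shift to `j + 1` makes the bound valid at `j = 0` too. The factor `2^a` comes from `j + 1 ≤
2j` for `j ≥ 1`. -/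
lemma exists_abs_le_of_tendsto_mul_rpow {u : ℕ → ℝ} {L a : ℝ} (ha0 : 0 ≤ a)
    (hu : Tendsto (fun j : ℕ => u j * (j : ℝ) ^ a) atTop (𝓝 L)) :
    ∃ K : ℝ, 0 ≤ K ∧ ∀ j : ℕ, |u j| ≤ K * ((j : ℝ) + 1) ^ (-a) := by
  obtain ⟨K, hK⟩ := hu.abs.bddAbove_range
  have hK' : ∀ j : ℕ, |u j| * (j : ℝ) ^ a ≤ K := fun j => by
    have : |u j * (j : ℝ) ^ a| ≤ K := hK ⟨j, rfl⟩
    rwa [abs_mul, abs_of_nonneg (by positivity : (0 : ℝ) ≤ (j : ℝ) ^ a)] at this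
  have hK0 : 0 ≤ K := le_trans (by positivity) (hK' 0)
  refine ⟨2 ^ a * K + |u 0|, by positivity, fun j => ?_⟩
  rw [Real.rpow_neg (by positivity), ← div_eq_mul_inv, le_div_iff₀ (by positivity)]
  rcases Nat.eq_zero_or_pos j with rfl | hj
  · simp only [Nat.cast_zero, zero_add, Real.one_rpow, mul_one]
    linarith [show (0 : ℝ) ≤ 2 ^ a * K by positivity]
  · have hj1 : (1 : ℝ) ≤ j := by exact_mod_cast hj
    calc |u j| * ((j : ℝ) + 1) ^ a ≤ |u j| * (2 * (j : ℝ)) ^ a := by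
          gcongr; linarith
      _ = 2 ^ a * (|u j| * (j : ℝ) ^ a) := by
          rw [Real.mul_rpow (by norm_num) (by positivity)]; ring
      _ ≤ 2 ^ a * K := by gcongr; exact hK' j
      _ ≤ _ := by linarith [abs_nonneg (u 0)]

/-- Up to the factor `n/(n + d)`, the sequence is the reciprocal of Euler's sequence `n^d n! / (d
(d+1) ⋯ (d+n))` for `Γ(d)`. -/
lemma tendsto_coeff_fracSeries {d : ℝ} (hd : 0 < d) :
    Tendsto (fun j : ℕ => PowerSeries.coeff j (fracSeries d) * (j : ℝ) ^ (1 - d)) atTop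
      (𝓝 (Real.Gamma d)⁻¹) := by
  have hprod : ∀ n : ℕ, ∏ j ∈ Finset.range n, (d + j) = (ascPochhammer ℝ n).eval d := by
    intro n
    induction n with
    | zero => simp
    | succ n ih => rw [Finset.prod_range_succ, ih, ascPochhammer_succ_eval]
  have hpos : ∀ n : ℕ, 0 < (ascPochhammer ℝ n).eval d := fun n => ascPochhammer_pos n d hd
  have h1 : Tendsto (fun n : ℕ => (n : ℝ) / (n + d)) atTop (𝓝 1) :=
    tendsto_natCast_div_add_atTop d
  have h2 := (Real.GammaSeq_tendsto_Gamma d).inv₀ (Real.Gamma_pos_of_pos hd).ne'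
  have h3 := h1.mul h2
  rw [one_mul] at h3
  refine h3.congr' ?_
  filter_upwards [eventually_gt_atTop 0] with n hn
  have hn' : (0 : ℝ) < n := by exact_mod_cast hn
  have hf : (n.factorial : ℝ) ≠ 0 := by exact_mod_cast n.factorial_ne_zero
  have hr : (n : ℝ) ^ d ≠ 0 := by positivity
  rw [Real.GammaSeq, hprod, ascPochhammer_succ_eval, fracSeries, PowerSeries.coeff_mk,
    Real.rpow_sub hn', Real.rpow_one]
  have := (hpos n).ne'
  have h5 : (n : ℝ) + d ≠ 0 := by positivity
  have h6 : d + (n : ℝ) ≠ 0 := by positivity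
  field_simp
  ring

/-- Filtering with a rapidly decaying filter preserves regular decay of the coefficients. -/
lemma tendsto_coeff_mul_rpow {F G : PowerSeries ℝ} {a L : ℝ} (ha0 : 0 ≤ a) (ha1 : a ≤ 1)
    (hF : WeightedSummable F)
    (hG : Tendsto (fun j : ℕ => PowerSeries.coeff j G * (j : ℝ) ^ a) atTop (𝓝 L)) :
    Tendsto (fun j : ℕ => PowerSeries.coeff j (F * G) * (j : ℝ) ^ a) atTop
      (𝓝 ((∑' k, PowerSeries.coeff k F) * L)) := by
  obtain ⟨K, hK0, hK⟩ := exists_abs_le_of_tendsto_mul_rpow ha0 hG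
  set f : ℕ → ℕ → ℝ := fun n k =>
    if k ≤ n then PowerSeries.coeff k F * PowerSeries.coeff (n - k) G * (n : ℝ) ^ a else 0 with hf
  have hsum : ∀ n, PowerSeries.coeff n (F * G) * (n : ℝ) ^ a = ∑' k, f n k := by
    intro n
    rw [tsum_eq_sum (s := Finset.range (n + 1)), PowerSeries.coeff_mul,
      Finset.Nat.sum_antidiagonal_eq_sum_range_succ_mk, Finset.sum_mul]
    · refine Finset.sum_congr rfl fun k hk => ?_
      rw [hf]; dsimp only
      rw [if_pos (by simpa [Nat.lt_succ_iff] using hk)]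
    · intro k hk
      rw [hf]; dsimp only
      rw [if_neg (by simpa [Nat.lt_succ_iff] using hk)]
  simp only [hsum, ← tsum_mul_right]
  -- Dominated convergence in the convolution index `k`. From `n ≤ (n-k+1)(k+1)` and `a ≤ 1`, `n^a ≤
  -- (n-k+1)^a (k+1)`: the first factor cancels the decay of `G`, the second is the weight carried
  -- by `F`.
  refine tendsto_tsum_of_dominated_convergence
    (bound := fun k => K * (‖PowerSeries.coeff k F‖ * ((k : ℝ) + 1))) (hF.mul_left K) ?_ ?_
  · intro k
    have h1 : Tendsto (fun n : ℕ => PowerSeries.coeff (n - k) G * ((n - k : ℕ) : ℝ) ^ a) atTop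
        (𝓝 L) := hG.comp (tendsto_sub_atTop_nat k)
    have h2 : Tendsto (fun n : ℕ => ((n : ℝ) / ((n - k : ℕ) : ℝ)) ^ a) atTop (𝓝 1) := by
      have h3 : Tendsto (fun n : ℕ => (((n + k : ℕ) : ℝ)) / (n : ℝ)) atTop (𝓝 1) := by
        have := (tendsto_const_div_atTop_nhds_zero_nat (k : ℝ)).const_add 1
        rw [add_zero] at this
        refine this.congr' ?_
        filter_upwards [eventually_gt_atTop 0] with n hn
        have : (n : ℝ) ≠ 0 := by exact_mod_cast hn.ne'
        push_cast
        field_simp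
      have h4 := (h3.comp (tendsto_sub_atTop_nat k))
      have h5 : Tendsto (fun n : ℕ => (n : ℝ) / ((n - k : ℕ) : ℝ)) atTop (𝓝 1) := by
        refine h4.congr' ?_
        filter_upwards [eventually_ge_atTop k] with n hn
        simp only [Function.comp, Nat.sub_add_cancel hn]
      simpa using h5.rpow_const (p := a) (Or.inl one_ne_zero)
    have h6 := (h1.mul h2).const_mul (PowerSeries.coeff k F)
    rw [mul_one] at h6
    refine h6.congr' ?_
    filter_upwards [eventually_gt_atTop k] with n hn
    have hpos : (0 : ℝ) < ((n - k : ℕ) : ℝ) := by exact_mod_cast Nat.sub_pos_of_lt hn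
    rw [hf]; dsimp only
    rw [if_pos hn.le, Real.div_rpow (by positivity) hpos.le]
    have : ((n - k : ℕ) : ℝ) ^ a ≠ 0 := by positivity
    field_simp
  · refine Eventually.of_forall fun n k => ?_
    rw [hf]; dsimp only
    split_ifs with hk
    · rw [norm_mul, norm_mul, Real.norm_of_nonneg (by positivity : (0 : ℝ) ≤ (n : ℝ) ^ a)]
      have h1 := hK (n - k)
      have h2 : (n : ℝ) ≤ (((n - k : ℕ) : ℝ) + 1) * ((k : ℝ) + 1) := by
        have : (n : ℝ) = ((n - k : ℕ) : ℝ) + k := by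
          rw [← Nat.cast_add, Nat.sub_add_cancel hk]
        rw [this]
        nlinarith [mul_nonneg (Nat.cast_nonneg (α := ℝ) (n - k)) (Nat.cast_nonneg (α := ℝ) k)]
      have h3 : (n : ℝ) ^ a ≤ (((n - k : ℕ) : ℝ) + 1) ^ a * ((k : ℝ) + 1) := by
        calc (n : ℝ) ^ a ≤ ((((n - k : ℕ) : ℝ) + 1) * ((k : ℝ) + 1)) ^ a := by gcongr
          _ = (((n - k : ℕ) : ℝ) + 1) ^ a * ((k : ℝ) + 1) ^ a := by
            rw [Real.mul_rpow (by positivity) (by positivity)]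
          _ ≤ _ := by
            gcongr
            exact Real.rpow_le_self_of_one_le (by simp) ha1
      calc _ ≤ ‖PowerSeries.coeff k F‖ * (K * (((n - k : ℕ) : ℝ) + 1) ^ (-a)) *
            ((((n - k : ℕ) : ℝ) + 1) ^ a * ((k : ℝ) + 1)) := by
            gcongr
            simpa using h1
        _ = K * (‖PowerSeries.coeff k F‖ * ((k : ℝ) + 1)) *
            ((((n - k : ℕ) : ℝ) + 1) ^ (-a) * (((n - k : ℕ) : ℝ) + 1) ^ a) := by ring
        _ = _ := by
          rw [← Real.rpow_add (by positivity), neg_add_cancel, Real.rpow_zero, mul_one]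
    · rw [norm_zero]; positivity

/-- The coefficients of a FARIMA filter are regularly varying of index `d - 1`. -/
lemma exists_tendsto_coeff_farimaSeries {A B : Polynomial ℝ} {d : ℝ} (hd0 : 0 < d) (hd1 : d < 1)
    (hA : A.Monic) (hAr : ∀ z : ℂ, 1 ≤ ‖z‖ → Polynomial.aeval z A ≠ 0)
    (hBr : ∀ z : ℂ, 1 ≤ ‖z‖ → Polynomial.aeval z B ≠ 0) :
    ∃ κ : ℝ, κ ≠ 0 ∧
      Tendsto (fun j : ℕ => PowerSeries.coeff j (farimaSeries A B d) * (j : ℝ) ^ (1 - d)) atTop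
        (𝓝 κ) := by
  obtain ⟨hW, hne⟩ := weightedSummable_arma hA hAr hBr
  exact ⟨_, mul_ne_zero hne (inv_ne_zero (Real.Gamma_pos_of_pos hd0).ne'),
    tendsto_coeff_mul_rpow (by linarith) (by linarith) hW (tendsto_coeff_fracSeries hd0)⟩

/-! ### Autocorrelation sums as Riemann sums -/

lemma integral_Ioi_floor_eq_tsum {a : ℕ → ℝ} (ha : Summable a) :
    ∫ x in Set.Ioi (0 : ℝ), a ⌊x⌋₊ = ∑' n, a n := by
  have hU : ⋃ n : ℕ, Set.Ico (n : ℝ) (n + 1) = Set.Ici 0 := by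
    ext x
    simp only [Set.mem_iUnion, Set.mem_Ico, Set.mem_Ici]
    exact ⟨fun ⟨n, h, _⟩ => (Nat.cast_nonneg n).trans h,
      fun h => ⟨⌊x⌋₊, Nat.floor_le h, Nat.lt_floor_add_one x⟩⟩
  have hd : Pairwise (Function.onFun Disjoint fun n : ℕ => Set.Ico (n : ℝ) (n + 1)) := by
    intro m n hmn
    refine Set.disjoint_left.2 fun x hx hx' => hmn ?_
    rw [← Nat.floor_eq_on_Ico m x hx, ← Nat.floor_eq_on_Ico n x hx']
  have hint : ∀ (g : ℝ → ℝ) (n : ℕ),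
      ∫ x in Set.Ico (n : ℝ) (n + 1), g (a ⌊x⌋₊) = g (a n) := by
    intro g n
    rw [setIntegral_congr_fun (g := fun _ => g (a n)) measurableSet_Ico
      fun x hx => by simp only [Nat.floor_eq_on_Ico n x hx]]
    simp
  have hion : ∀ n : ℕ, IntegrableOn (fun x : ℝ => a ⌊x⌋₊) (Set.Ico (n : ℝ) (n + 1)) := by
    intro n
    refine (integrableOn_const (C := a n) (by simp)).congr_fun (fun x hx => ?_) measurableSet_Ico
    simp only [Nat.floor_eq_on_Ico n x hx]
  have hi := integrableOn_iUnion_of_summable_integral_norm hion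
    (by simpa only [hint] using ha.norm)
  have hs := hasSum_integral_iUnion (fun n : ℕ => measurableSet_Ico) hd hi
  rw [hU] at hs
  rw [← integral_Ici_eq_integral_Ioi, ← hs.tsum_eq]
  exact tsum_congr fun n => hint id n

/-- Integrability at `0` uses `a < 1`; at infinity the integrand is at most `x^(-2a)` and `2a > 1`.
With `a = 1 - d` this is the range `0 < d < 1/2`. -/
lemma integrableOn_rpow_mul_rpow_add_one {a : ℝ} (ha0 : 1 / 2 < a) (ha1 : a < 1) :
    IntegrableOn (fun x : ℝ => x ^ (-a) * (x + 1) ^ (-a)) (Set.Ioi 0) := by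
  have hm : Measurable fun x : ℝ => x ^ (-a) * (x + 1) ^ (-a) := by fun_prop
  rw [← Set.Ioc_union_Ioi_eq_Ioi zero_le_one]
  refine IntegrableOn.union ?_ ?_
  · have h1 : IntegrableOn (fun x : ℝ => x ^ (-a)) (Set.Ioc 0 1) := by
      have := intervalIntegral.intervalIntegrable_rpow' (a := 0) (b := 1)
        (by linarith : -1 < -a)
      rwa [intervalIntegrable_iff_integrableOn_Ioc_of_le zero_le_one] at this
    refine Integrable.mono' h1 hm.aestronglyMeasurable ?_
    filter_upwards [ae_restrict_mem measurableSet_Ioc] with x hx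
    have hx0 : 0 < x := hx.1
    rw [Real.norm_of_nonneg (by positivity)]
    exact mul_le_of_le_one_right (by positivity)
      (Real.rpow_le_one_of_one_le_of_nonpos (by linarith) (by linarith))
  · have h1 := integrableOn_Ioi_rpow_of_lt (by linarith : -a + -a < -1) one_pos
    refine Integrable.mono' h1 hm.aestronglyMeasurable ?_
    filter_upwards [ae_restrict_mem measurableSet_Ioi] with x hx
    have hx0 : 0 < x := one_pos.trans hx
    rw [Real.norm_of_nonneg (by positivity), Real.rpow_add hx0]
    gcongr ?_ * ?_
    exact Real.rpow_le_rpow_of_nonpos hx0 (by linarith) (by linarith)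

lemma integral_rpow_mul_rpow_add_one_pos {a : ℝ} (ha0 : 1 / 2 < a) (ha1 : a < 1) :
    0 < ∫ x in Set.Ioi (0 : ℝ), x ^ (-a) * (x + 1) ^ (-a) := by
  rw [setIntegral_pos_iff_support_of_nonneg_ae ?_ (integrableOn_rpow_mul_rpow_add_one ha0 ha1)]
  · have : Function.support (fun x : ℝ => x ^ (-a) * (x + 1) ^ (-a)) ∩ Set.Ioi 0 = Set.Ioi 0 := by
      refine Set.inter_eq_right.2 fun x hx => ?_
      have hx0 : (0 : ℝ) < x := hx
      rw [Function.mem_support]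
      positivity
    rw [this]
    simp
  · filter_upwards [ae_restrict_mem measurableSet_Ioi] with x hx
    have hx0 : (0 : ℝ) < x := hx
    simp only [Pi.zero_apply]
    positivity

/-- Regular decay evaluated along an integer sequence that grows linearly. -/
lemma tendsto_mul_rpow_comp {u : ℕ → ℝ} {κ a y : ℝ} (hy : 0 < y)
    (hu : Tendsto (fun j : ℕ => u j * (j : ℝ) ^ a) atTop (𝓝 κ)) {m : ℕ → ℕ}
    (hm : Tendsto m atTop atTop)
    (hmy : Tendsto (fun h : ℕ => (m h : ℝ) / h) atTop (𝓝 y)) :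
    Tendsto (fun h : ℕ => u (m h) * (h : ℝ) ^ a) atTop (𝓝 (κ * y ^ (-a))) := by
  refine ((hu.comp hm).mul (hmy.rpow_const (p := -a) (Or.inl hy.ne'))).congr' ?_
  filter_upwards [hm.eventually_gt_atTop 0, eventually_gt_atTop 0] with h hmh hh
  have h1 : (0 : ℝ) < m h := by exact_mod_cast hmh
  have h2 : (0 : ℝ) < h := by exact_mod_cast hh
  simp only [Function.comp]
  rw [Real.div_rpow h1.le h2.le, Real.rpow_neg h1.le, Real.rpow_neg h2.le]
  have h3 : (m h : ℝ) ^ a ≠ 0 := by positivity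
  have h4 : (h : ℝ) ^ a ≠ 0 := by positivity
  field_simp

lemma summable_mul_shift {u : ℕ → ℝ} {K a : ℝ} (ha0 : 1 / 2 < a)
    (hK : ∀ j : ℕ, |u j| ≤ K * ((j : ℝ) + 1) ^ (-a)) (h : ℕ) :
    Summable fun j => u j * u (j + h) := by
  have h1 : Summable fun j : ℕ => K * K * ((j : ℝ) + 1) ^ (-a + -a) := by
    have := (summable_nat_add_iff 1).2 (Real.summable_nat_rpow.2 (by linarith : -a + -a < -1))
    simpa using this.mul_left (K * K)
  have hK0 : 0 ≤ K := by simpa using (abs_nonneg _).trans (hK 0)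
  refine Summable.of_norm_bounded h1 fun j => ?_
  have hj : (0 : ℝ) < (j : ℝ) + 1 := by positivity
  rw [norm_mul, Real.norm_eq_abs, Real.norm_eq_abs]
  calc |u j| * |u (j + h)| ≤ (K * ((j : ℝ) + 1) ^ (-a)) * (K * ((j : ℝ) + 1) ^ (-a)) := by
        gcongr
        · exact hK j
        · refine (hK (j + h)).trans ?_
          gcongr ?_ * ?_
          exact Real.rpow_le_rpow_of_nonpos hj (by push_cast; linarith [Nat.cast_nonneg (α := ℝ) h])
            (by linarith)
    _ = _ := by rw [Real.rpow_add hj]; ring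

/-- The autocorrelation sums of a regularly decaying sequence are regularly decaying. -/
lemma tendsto_tsum_mul_shift {u : ℕ → ℝ} {κ a : ℝ} (ha0 : 1 / 2 < a) (ha1 : a < 1)
    (hu : Tendsto (fun j : ℕ => u j * (j : ℝ) ^ a) atTop (𝓝 κ)) :
    Tendsto (fun h : ℕ => (∑' j, u j * u (j + h)) * (h : ℝ) ^ (2 * a - 1)) atTop
      (𝓝 (κ ^ 2 * ∫ x in Set.Ioi (0 : ℝ), x ^ (-a) * (x + 1) ^ (-a))) := by
  obtain ⟨K, hK0, hK⟩ := exists_abs_le_of_tendsto_mul_rpow (by linarith) hu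
  -- The sum over `j` is the integral of a step function; substituting `j = ⌊h x⌋` and rescaling
  -- each factor by `h^a` gives an integrand with a pointwise limit.
  set F : ℕ → ℝ → ℝ := fun h x =>
    (u ⌊(h : ℝ) * x⌋₊ * (h : ℝ) ^ a) * (u (⌊(h : ℝ) * x⌋₊ + h) * (h : ℝ) ^ a) with hF
  -- The index `h + 1` avoids `h = 0`, where the rescaling degenerates and the domination is not
  -- available.
  have key : Tendsto (fun h : ℕ => ∫ x in Set.Ioi (0 : ℝ), F (h + 1) x) atTop
      (𝓝 (∫ x in Set.Ioi (0 : ℝ), κ ^ 2 * (x ^ (-a) * (x + 1) ^ (-a)))) := by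
    refine tendsto_integral_of_dominated_convergence
      (fun x => K * K * (x ^ (-a) * (x + 1) ^ (-a))) ?_ ?_ ?_ ?_
    · intro h
      have hfl : Measurable fun x : ℝ => ⌊((h + 1 : ℕ) : ℝ) * x⌋₊ :=
        Nat.measurable_floor.comp (measurable_const_mul _)
      have h1 : Measurable fun x : ℝ => u ⌊((h + 1 : ℕ) : ℝ) * x⌋₊ :=
        (measurable_from_nat (f := u)).comp hfl
      have h2 : Measurable fun x : ℝ => u (⌊((h + 1 : ℕ) : ℝ) * x⌋₊ + (h + 1)) :=
        (measurable_from_nat (f := fun n => u (n + (h + 1)))).comp hfl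
      exact ((h1.mul_const _).mul (h2.mul_const _)).aestronglyMeasurable
    · exact (integrableOn_rpow_mul_rpow_add_one ha0 ha1).const_mul _
    · intro h'
      filter_upwards [ae_restrict_mem measurableSet_Ioi] with x hx
      set h := h' + 1 with hh'
      have hx0 : (0 : ℝ) < x := hx
      have hh : (0 : ℝ) < h := by rw [hh']; positivity
      have hfl := (Nat.lt_floor_add_one ((h : ℝ) * x)).le
      have hha : (h : ℝ) ^ (-a) * (h : ℝ) ^ a = 1 := by
        rw [← Real.rpow_add hh, neg_add_cancel, Real.rpow_zero]
      have b1 : |u ⌊(h : ℝ) * x⌋₊| ≤ K * ((h : ℝ) ^ (-a) * x ^ (-a)) := by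
        refine (hK _).trans ?_
        rw [← Real.mul_rpow hh.le hx0.le]
        gcongr ?_ * ?_
        exact Real.rpow_le_rpow_of_nonpos (by positivity) hfl (by linarith)
      have b2 : |u (⌊(h : ℝ) * x⌋₊ + h)| ≤ K * ((h : ℝ) ^ (-a) * (x + 1) ^ (-a)) := by
        refine (hK _).trans ?_
        rw [← Real.mul_rpow hh.le (by positivity)]
        gcongr ?_ * ?_
        refine Real.rpow_le_rpow_of_nonpos (by positivity) ?_ (by linarith)
        push_cast
        linarith
      simp only [hF]
      rw [norm_mul, norm_mul, norm_mul, Real.norm_of_nonneg (by positivity : (0 : ℝ) ≤ (h : ℝ) ^ a)]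
      calc ‖u ⌊(h : ℝ) * x⌋₊‖ * (h : ℝ) ^ a * (‖u (⌊(h : ℝ) * x⌋₊ + h)‖ * (h : ℝ) ^ a)
          ≤ (K * ((h : ℝ) ^ (-a) * x ^ (-a))) * (h : ℝ) ^ a *
            ((K * ((h : ℝ) ^ (-a) * (x + 1) ^ (-a))) * (h : ℝ) ^ a) := by
            gcongr
            · exact b1
            · exact b2
        _ = K * K * (x ^ (-a) * (x + 1) ^ (-a)) *
            ((h : ℝ) ^ (-a) * (h : ℝ) ^ a) * ((h : ℝ) ^ (-a) * (h : ℝ) ^ a) := by ring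
        _ = _ := by rw [hha, mul_one, mul_one]
    · filter_upwards [ae_restrict_mem measurableSet_Ioi] with x hx
      have hx0 : (0 : ℝ) < x := hx
      have m1 : Tendsto (fun h : ℕ => ⌊(h : ℝ) * x⌋₊) atTop atTop :=
        tendsto_nat_floor_atTop.comp (tendsto_natCast_atTop_atTop.atTop_mul_const hx0)
      have m2 : Tendsto (fun h : ℕ => (⌊(h : ℝ) * x⌋₊ : ℝ) / h) atTop (𝓝 x) := by
        have := (tendsto_nat_floor_mul_div_atTop hx0.le).comp
          (tendsto_natCast_atTop_atTop (R := ℝ))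
        simpa only [Function.comp_def, mul_comm] using this
      have m3 : Tendsto (fun h : ℕ => ((⌊(h : ℝ) * x⌋₊ + h : ℕ) : ℝ) / h) atTop (𝓝 (x + 1)) := by
        refine (m2.add_const 1).congr' ?_
        filter_upwards [eventually_gt_atTop 0] with h hh
        have : (h : ℝ) ≠ 0 := by exact_mod_cast hh.ne'
        push_cast
        field_simp
      have t1 := tendsto_mul_rpow_comp hx0 hu m1 m2
      have t2 := tendsto_mul_rpow_comp (by positivity : 0 < x + 1) hu
        (tendsto_atTop_mono (fun h => Nat.le_add_left h _) tendsto_id) m3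
      have t3 := (t1.mul t2).comp (tendsto_add_atTop_nat 1)
      rw [show κ * x ^ (-a) * (κ * (x + 1) ^ (-a)) = κ ^ 2 * (x ^ (-a) * (x + 1) ^ (-a)) by ring]
        at t3
      exact t3
  rw [integral_const_mul, tendsto_add_atTop_iff_nat (f := fun h => ∫ x in Set.Ioi (0 : ℝ), F h x)]
    at key
  refine key.congr' ?_
  filter_upwards [eventually_gt_atTop 0] with h hh
  have hh0 : (0 : ℝ) < h := by exact_mod_cast hh
  have h1 := integral_Ioi_floor_eq_tsum (summable_mul_shift ha0 hK h)
  have h2 := integral_comp_mul_left_Ioi (fun x : ℝ => u ⌊x⌋₊ * u (⌊x⌋₊ + h)) 0 hh0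
  rw [mul_zero, h1] at h2
  have h3 : ∀ x, F h x = (h : ℝ) ^ (2 * a) * (u ⌊(h : ℝ) * x⌋₊ * u (⌊(h : ℝ) * x⌋₊ + h)) := by
    intro x
    rw [hF, two_mul, Real.rpow_add hh0]; ring
  simp only [h3]
  rw [integral_const_mul, h2, Real.rpow_sub hh0, Real.rpow_one, smul_eq_mul]
  ring

/-! ### Covariances of moving averages and of FARIMA processes -/

section MovingAverage

variable {Ω : Type*} [MeasurableSpace Ω] {μ : Measure Ω}

lemma memLp_two_of_tendsto_eLpNorm {U : Ω → ℝ} {S : ℕ → Ω → ℝ}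
    (hU : Measurable U) (hS : ∀ N, MemLp (S N) 2 μ)
    (h : Tendsto (fun N => eLpNorm (fun ω => U ω - S N ω) 2 μ) atTop (𝓝 0)) : MemLp U 2 μ := by
  -- One partial sum at finite `L²` distance already suffices.
  obtain ⟨N, hN⟩ := (h.eventually_lt_const ENNReal.zero_lt_top).exists
  have h1 : MemLp (fun ω => U ω - S N ω) 2 μ :=
    ⟨hU.aestronglyMeasurable.sub (hS N).aestronglyMeasurable, hN⟩
  convert h1.add (hS N) using 1
  ext ω
  simp

/-- Joint continuity of the inner product of `L²`. -/
lemma tendsto_integral_mul_of_tendsto_eLpNorm {U V : Ω → ℝ} {S R : ℕ → Ω → ℝ}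
    (hU : MemLp U 2 μ) (hV : MemLp V 2 μ) (hS : ∀ N, MemLp (S N) 2 μ) (hR : ∀ N, MemLp (R N) 2 μ)
    (hSU : Tendsto (fun N => eLpNorm (fun ω => U ω - S N ω) 2 μ) atTop (𝓝 0))
    (hRV : Tendsto (fun N => eLpNorm (fun ω => V ω - R N ω) 2 μ) atTop (𝓝 0)) :
    Tendsto (fun N => ∫ ω, S N ω * R N ω ∂μ) atTop (𝓝 (∫ ω, U ω * V ω ∂μ)) := by
  have aux : ∀ {f g : Ω → ℝ} (hf : MemLp f 2 μ) (hg : MemLp g 2 μ),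
      inner ℝ (hf.toLp f) (hg.toLp g) = ∫ ω, f ω * g ω ∂μ := by
    intro f g hf hg
    rw [L2.inner_def]
    refine integral_congr_ae ?_
    filter_upwards [hf.coeFn_toLp, hg.coeFn_toLp] with ω h1 h2
    rw [h1, h2]
    simp [mul_comm]
  have conv : ∀ {W : Ω → ℝ} {Q : ℕ → Ω → ℝ} (hW : MemLp W 2 μ) (hQ : ∀ N, MemLp (Q N) 2 μ),
      Tendsto (fun N => eLpNorm (fun ω => W ω - Q N ω) 2 μ) atTop (𝓝 0) →
      Tendsto (fun N => (hQ N).toLp (Q N)) atTop (𝓝 (hW.toLp W)) := by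
    intro W Q hW hQ h
    rw [Lp.tendsto_Lp_iff_tendsto_eLpNorm'']
    refine h.congr fun N => ?_
    rw [← eLpNorm_neg]
    congr 1
    ext ω
    simp
  have := (conv hU hS hSU).inner (𝕜 := ℝ) (conv hV hR hRV)
  simpa only [aux] using this

lemma IsWhiteNoise.exists_cov {ε : ℤ → Ω → ℝ} (hε : IsWhiteNoise ε μ) :
    ∃ v : ℝ, 0 < v ∧ ∀ m n, cov[ε m, ε n; μ] = if m = n then v else 0 := by
  obtain ⟨v, hv, hvar⟩ := hε.variance
  refine ⟨v, hv, fun m n => ?_⟩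
  split_ifs with h
  · rw [h, covariance_self (hε.memLp n).aestronglyMeasurable.aemeasurable, hvar]
  · exact hε.uncorrelated m n h

/-- Second order structure of a one-sided moving average of a white noise. -/
lemma IsWhiteNoise.movingAverage [IsProbabilityMeasure μ] {ε : ℤ → Ω → ℝ}
    (hε : IsWhiteNoise ε μ) {ψ : ℕ → ℝ} (hψ : ∀ h, Summable fun j => ψ j * ψ (j + h))
    {X : ℕ → Ω → ℝ} (hXm : ∀ n, Measurable (X n))
    (hX : ∀ n : ℕ, Tendsto (fun N : ℕ => eLpNorm (fun ω => X n ω -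
      ∑ j ∈ Finset.range N, ψ j * ε ((n : ℤ) - (j : ℤ)) ω) 2 μ) atTop (𝓝 0)) :
    (∀ n, MemLp (X n) 2 μ) ∧ (∀ n, ∫ ω, X n ω ∂μ = 0) ∧
      ∃ v : ℝ, 0 < v ∧ ∀ n h, cov[X n, X (n + h); μ] = v * ∑' j, ψ j * ψ (j + h) := by
  set S : ℕ → ℕ → Ω → ℝ := fun n N ω =>
    ∑ j ∈ Finset.range N, ψ j * ε ((n : ℤ) - (j : ℤ)) ω with hS
  have hterm : ∀ n j : ℕ, MemLp (fun ω => ψ j * ε ((n : ℤ) - (j : ℤ)) ω) 2 μ := fun n j =>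
    (hε.memLp _).const_mul _
  have hSmem : ∀ n N, MemLp (S n N) 2 μ := fun n N => memLp_finsetSum _ fun j _ => hterm n j
  have hXmem : ∀ n, MemLp (X n) 2 μ := fun n =>
    memLp_two_of_tendsto_eLpNorm (hXm n) (hSmem n) (hX n)
  have hSmean : ∀ n N, ∫ ω, S n N ω ∂μ = 0 := by
    intro n N
    rw [hS]; dsimp only
    rw [integral_finsetSum _ fun j _ => (hterm n j).integrable (by norm_num)]
    simp [integral_const_mul, hε.mean]
  have hXmean : ∀ n, ∫ ω, X n ω ∂μ = 0 := by
    intro n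
    -- Pairing with the constant `1` passes the zero mean to the limit.
    have h1 := tendsto_integral_mul_of_tendsto_eLpNorm (hXmem n) (memLp_const (1 : ℝ)) (hSmem n)
      (fun _ => memLp_const (1 : ℝ)) (hX n) (by simp)
    simp only [mul_one, hSmean] at h1
    exact tendsto_nhds_unique h1 tendsto_const_nhds
  obtain ⟨v, hv, hcov⟩ := hε.exists_cov
  refine ⟨hXmem, hXmean, v, hv, fun n h => ?_⟩
  -- Taking `N + h` terms in the second sum gives each `j < N` its partner `j + h`, the only index
  -- with the same noise variable.
  have hScov : ∀ N, ∫ ω, S n N ω * S (n + h) (N + h) ω ∂μ =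
      v * ∑ j ∈ Finset.range N, ψ j * ψ (j + h) := by
    intro N
    have h1 := covariance_eq_sub (hSmem n N) (hSmem (n + h) (N + h))
    rw [hSmean, zero_mul, sub_zero] at h1
    change _ = ∫ ω, S n N ω * S (n + h) (N + h) ω ∂μ at h1
    rw [← h1, hS]; dsimp only
    rw [covariance_fun_sum_fun_sum' (fun j _ => hterm n j) (fun j _ => hterm (n + h) j),
      Finset.mul_sum]
    refine Finset.sum_congr rfl fun j hj => ?_
    rw [Finset.sum_eq_single (j + h)]
    · rw [covariance_const_mul_left, covariance_const_mul_right, hcov, if_pos (by push_cast; ring)]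
      ring
    · intro i _ hi
      rw [covariance_const_mul_left, covariance_const_mul_right, hcov,
        if_neg (by push_cast; omega)]
      ring
    · intro hnot
      exact absurd (Finset.mem_range.2 (by have := Finset.mem_range.1 hj; omega)) hnot
  have h2 := tendsto_integral_mul_of_tendsto_eLpNorm (hXmem n) (hXmem (n + h)) (hSmem n)
    (fun N => hSmem (n + h) (N + h)) (hX n) ((hX (n + h)).comp (tendsto_add_atTop_nat h))
  simp only [hScov] at h2
  rw [covariance_eq_sub (hXmem n) (hXmem (n + h)), hXmean, zero_mul, sub_zero]
  exact tendsto_nhds_unique h2 ((hψ h).hasSum.tendsto_sum_nat.const_mul v)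

/-- Covariance asymptotics of a FARIMA process. -/
lemma IsFARIMA.secondOrder [IsProbabilityMeasure μ] {p q : ℕ} {d : ℝ} (hd0 : 0 < d)
    (hd1 : d < 1 / 2) {X : ℕ → Ω → ℝ} (hXm : ∀ n, Measurable (X n)) (hX : IsFARIMA p d q X μ) :
    IsSecondOrderStationary X μ ∧ (∀ n, ∫ ω, X n ω ∂μ = 0) ∧
      ∃ C : ℝ, 0 < C ∧
        Tendsto (fun h : ℕ => autocov X μ h * (h : ℝ) ^ (1 - 2 * d)) atTop (𝓝 C) := by
  obtain ⟨A, B, ε, hA, -, hAr, -, -, hBr, hε, hlim⟩ := hX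
  obtain ⟨κ, hκ, hψ⟩ := exists_tendsto_coeff_farimaSeries hd0 (by linarith) hA hAr hBr
  obtain ⟨K, -, hK⟩ := exists_abs_le_of_tendsto_mul_rpow (by linarith) hψ
  obtain ⟨hmem, hmean, v, hv, hcov⟩ := hε.movingAverage
    (ψ := fun j => PowerSeries.coeff j (farimaSeries A B d))
    (summable_mul_shift (by linarith) hK) hXm hlim
  have hauto : ∀ h, autocov X μ h = v * ∑' j, PowerSeries.coeff j (farimaSeries A B d) *
      PowerSeries.coeff (j + h) (farimaSeries A B d) := fun h => by
    simpa [autocov] using hcov 0 h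
  refine ⟨⟨hmem, fun n => by rw [hmean, hmean], fun n h => ?_⟩, hmean, _,
    mul_pos hv (mul_pos (pow_pos (abs_pos.2 hκ) 2)
      (integral_rpow_mul_rpow_add_one_pos (a := 1 - d) (by linarith) (by linarith))), ?_⟩
  · rw [hcov, ← hauto, autocov]
  · have h1 := (tendsto_tsum_mul_shift (by linarith) (by linarith) hψ).const_mul v
    rw [sq_abs]
    refine h1.congr fun h => ?_
    rw [hauto, show 2 * (1 - d) - 1 = 1 - 2 * d by ring, mul_assoc]

end MovingAverage

/-! ### Evaluation at an independent random index -/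

section RandomIndex

variable {Ω : Type*} [MeasurableSpace Ω] {μ : Measure Ω} [IsProbabilityMeasure μ]
  {ι : Type*} [Countable ι] [MeasurableSpace ι] [MeasurableSingletonClass ι]

lemma summable_mul_real_preimage_singleton {J : Ω → ι} (hJ : Measurable J) {a : ι → ℝ} {K : ℝ}
    (ha : ∀ i, 0 ≤ a i) (hK : ∀ i, a i ≤ K) : Summable fun i => a i * μ.real (J ⁻¹' {i}) := by
  have h1 := hasSum_integral_iUnion (fun i => hJ (measurableSet_singleton i))
    (fun i j hij => Disjoint.preimage J (Set.disjoint_singleton.2 hij))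
    (f := fun _ => (1 : ℝ)) (μ := μ) (integrable_const _).integrableOn
  have h2 : Summable fun i => μ.real (J ⁻¹' {i}) := by simpa using h1.summable
  refine Summable.of_nonneg_of_le (fun i => mul_nonneg (ha i) measureReal_nonneg) (fun i => ?_)
    (h2.mul_left K)
  gcongr
  exact hK i

set_option linter.unusedSectionVars false in
/-- Expectation of a family of random variables evaluated at an independent random index. -/
lemma hasSum_integral_comp_indep {W : ι → Ω → ℝ} {J : Ω → ι} (hJ : Measurable J)
    (hW : ∀ i, Integrable (W i) μ)
    (hsummable : Summable fun i => (∫ ω, |W i ω| ∂μ) * μ.real (J ⁻¹' {i}))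
    (hind : ∀ i, IndepFun (W i) J μ) :
    Integrable (fun ω => W (J ω) ω) μ ∧
      HasSum (fun i => (∫ ω, W i ω ∂μ) * μ.real (J ⁻¹' {i})) (∫ ω, W (J ω) ω ∂μ) := by
  have hms : ∀ i, MeasurableSet (J ⁻¹' {i}) := fun i => hJ (measurableSet_singleton i)
  have hU : ⋃ i, J ⁻¹' {i} = Set.univ := by
    ext ω; simp
  have hd : Pairwise (Function.onFun Disjoint fun i => J ⁻¹' {i}) := by
    intro i j hij
    exact Disjoint.preimage J (Set.disjoint_singleton.2 hij)
  -- On `{J = i}` the index is frozen and independence factors the integral. Used with `g = |·|` for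
  -- integrability and `g = id` for the value.
  have hpiece : ∀ (g : ℝ → ℝ), Measurable g → ∀ i, ∫ ω in J ⁻¹' {i}, g (W (J ω) ω) ∂μ =
      (∫ ω, g (W i ω) ∂μ) * μ.real (J ⁻¹' {i}) := by
    intro g hg i
    have h1 : ∫ ω in J ⁻¹' {i}, g (W (J ω) ω) ∂μ = ∫ ω in J ⁻¹' {i}, g (W i ω) ∂μ := by
      refine setIntegral_congr_fun (hms i) fun ω hω => ?_
      rw [Set.mem_preimage, Set.mem_singleton_iff] at hω
      simp only [hω]
    have h2 : Measurable (Set.indicator {i} fun _ : ι => (1 : ℝ)) :=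
      measurable_const.indicator (measurableSet_singleton i)
    have h3 := ((hind i).comp hg h2).integral_fun_mul_eq_mul_integral
      (hg.comp_aemeasurable (hW i).aestronglyMeasurable.aemeasurable).aestronglyMeasurable
      (h2.comp hJ).aestronglyMeasurable
    have h4 : ∀ ω, (Set.indicator {i} (fun _ : ι => (1 : ℝ)) ∘ J) ω =
        (J ⁻¹' {i}).indicator (fun _ => (1 : ℝ)) ω := fun ω => rfl
    rw [h1, ← integral_indicator (hms i)]
    simp only [h4] at h3
    rw [integral_indicator (hms i), setIntegral_const, smul_eq_mul, mul_one] at h3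
    simp only [Function.comp] at h3
    rw [← h3]
    refine integral_congr_ae (Eventually.of_forall fun ω => ?_)
    by_cases hω : ω ∈ J ⁻¹' {i} <;> simp [hω]
  have hion : ∀ i, IntegrableOn (fun ω => W (J ω) ω) (J ⁻¹' {i}) μ := by
    intro i
    refine (hW i).integrableOn.congr_fun (fun ω hω => ?_) (hms i)
    rw [Set.mem_preimage, Set.mem_singleton_iff] at hω
    simp only [hω]
  have hint : IntegrableOn (fun ω => W (J ω) ω) (⋃ i, J ⁻¹' {i}) μ := by
    refine integrableOn_iUnion_of_summable_integral_norm hion (hsummable.congr fun i => ?_)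
    simp only [Real.norm_eq_abs, hpiece (fun x => |x|) measurable_abs i]
  have hsum := hasSum_integral_iUnion hms hd hint
  rw [hU, setIntegral_univ] at hsum
  refine ⟨by rwa [hU, integrableOn_univ] at hint, hsum.congr_fun ?_⟩
  exact fun i => (hpiece id measurable_id i).symm

lemma hasSum_integral_comp {J : Ω → ι} (hJ : Measurable J) {a : ι → ℝ}
    (ha : Summable fun i => |a i| * μ.real (J ⁻¹' {i})) :
    Integrable (fun ω => a (J ω)) μ ∧
      HasSum (fun i => a i * μ.real (J ⁻¹' {i})) (∫ ω, a (J ω) ∂μ) := by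
  have h := hasSum_integral_comp_indep (W := fun i _ => a i) (μ := μ) hJ
    (fun i => integrable_const _) (by simpa using ha) (fun i => indepFun_const_left _ _)
  simpa using h

/-- Both sides expand into the same series over the values of `J`; the uniform `L¹` bound makes the
series converge. -/
lemma integral_comp_indep {W : ι → Ω → ℝ} {J : Ω → ι} {K : ℝ} (hJ : Measurable J)
    (hW : ∀ i, Integrable (W i) μ) (hK : ∀ i, ∫ ω, |W i ω| ∂μ ≤ K)
    (hind : ∀ i, IndepFun (W i) J μ) :
    ∫ ω, W (J ω) ω ∂μ = ∫ ω, (∫ ω', W (J ω) ω' ∂μ) ∂μ := by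
  have h1 := (hasSum_integral_comp_indep hJ hW (summable_mul_real_preimage_singleton hJ
    (fun i => integral_nonneg fun _ => abs_nonneg _) hK) hind).2
  have h2 := (hasSum_integral_comp (μ := μ) hJ (a := fun i => ∫ ω', W i ω' ∂μ)
    (summable_mul_real_preimage_singleton hJ (fun i => abs_nonneg _)
      fun i => (abs_integral_le_integral_abs).trans (hK i))).2
  exact h1.unique h2

end RandomIndex

/-! ### Stationarity of the walk's increments -/

lemma sum_range_step {Ω : Type*} (T : ℕ → Ω → ℕ) (n h : ℕ) (ω : Ω) :
    ∑ i ∈ Finset.range h, ((T (n + i + 1) ω : ℤ) - (T (n + i) ω : ℤ)) =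
      (T (n + h) ω : ℤ) - (T n ω : ℤ) :=
  Finset.sum_range_sub (fun i => (T (n + i) ω : ℤ)) h

section Walk

variable {Ω : Type*} [MeasurableSpace Ω] {μ : Measure Ω} {T : ℕ → Ω → ℕ}

lemma IsSamplingWalk.ae_strictMono (hT : IsSamplingWalk T μ) :
    ∀ᵐ ω ∂μ, StrictMono fun n => T n ω := by
  filter_upwards [ae_all_iff.2 hT.step_pos] with ω hω
  exact strictMono_nat_of_lt_succ hω

lemma IsSamplingWalk.ae_le (hT : IsSamplingWalk T μ) : ∀ᵐ ω ∂μ, ∀ n, n ≤ T n ω := by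
  filter_upwards [hT.ae_strictMono] with ω hω n
  exact hω.id_le n

/-- The sequence of steps from time `n` on has the law of the sequence of steps from time `0`, and
both variables are the same function of these sequences. -/
lemma IsSamplingWalk.identDistrib_sub (hT : IsSamplingWalk T μ) (n h : ℕ) :
    IdentDistrib (fun ω => T (n + h) ω - T n ω) (T h) μ μ := by
  have h1 : IdentDistrib (fun ω (i : ℕ) => (T (n + i + 1) ω : ℤ) - (T (n + i) ω : ℤ))
      (fun ω (i : ℕ) => (T (i + 1) ω : ℤ) - (T i ω : ℤ)) μ μ :=
    IdentDistrib.pi (fun i => (hT.identDistrib (n + i)).trans (hT.identDistrib i).symm)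
      (hT.indep.precomp (g := fun i => n + i) (add_right_injective n)) hT.indep
  have h2 := h1.comp (u := fun f : ℕ → ℤ => (∑ i ∈ Finset.range h, f i).toNat)
    ((measurable_from_top (f := Int.toNat)).comp
      (Finset.measurable_sum (Finset.range h) fun i _ => measurable_pi_apply i))
  -- `Int.toNat` matches truncated subtraction, so this holds everywhere, including on the null set
  -- where `T` may decrease.
  have e1 : (fun ω => T (n + h) ω - T n ω) = (fun f : ℕ → ℤ => (∑ i ∈ Finset.range h, f i).toNat) ∘
      fun ω (i : ℕ) => (T (n + i + 1) ω : ℤ) - (T (n + i) ω : ℤ) := by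
    ext ω
    simp only [Function.comp, sum_range_step]
    omega
  have e2 : T h = (fun f : ℕ → ℤ => (∑ i ∈ Finset.range h, f i).toNat) ∘
      fun ω (i : ℕ) => (T (i + 1) ω : ℤ) - (T i ω : ℤ) := by
    ext ω
    have := sum_range_step T 0 h ω
    simp only [zero_add, hT.zero, Nat.cast_zero, sub_zero] at this
    simp only [Function.comp, this]
    simp
  rw [e1, e2]
  exact h2

end Walk

/-! ### Second order structure of the sampled process -/

section Sampled

variable {Ω : Type*} [MeasurableSpace Ω] {μ : Measure Ω} [IsProbabilityMeasure μ]
  {X : ℕ → Ω → ℝ} {T : ℕ → Ω → ℕ}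

lemma measurable_sampled (hXm : ∀ n, Measurable (X n)) (hTm : ∀ n, Measurable (T n)) (n : ℕ) :
    Measurable (sampled X T n) :=
  (measurable_from_prod_countable_right (f := fun z : ℕ × Ω => X z.1 z.2) hXm).comp
    ((hTm n).prodMk measurable_id)

lemma IsSecondOrderStationary.integral_mul (hX : IsSecondOrderStationary X μ)
    (hmean : ∀ n, ∫ ω, X n ω ∂μ = 0) {k l : ℕ} (hkl : k ≤ l) :
    ∫ ω, X k ω * X l ω ∂μ = autocov X μ (l - k) := by
  have h1 := covariance_eq_sub (hX.memLp k) (hX.memLp l)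
  rw [hmean, zero_mul, sub_zero] at h1
  have h2 := hX.cov k (l - k)
  rw [Nat.add_sub_cancel' hkl] at h2
  rw [autocov, ← h2, h1]
  rfl

/-- From `2|xy| ≤ x² + y²` and stationarity. Uniformity in `k, l` is what evaluation at the random
pair of times needs. -/
lemma IsSecondOrderStationary.integral_abs_mul_le (hX : IsSecondOrderStationary X μ)
    (hmean : ∀ n, ∫ ω, X n ω ∂μ = 0) (k l : ℕ) :
    ∫ ω, |X k ω * X l ω| ∂μ ≤ autocov X μ 0 := by
  have hsq : ∀ n, Integrable (fun ω => X n ω * X n ω) μ := fun n =>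
    (hX.memLp n).integrable_mul (hX.memLp n)
  have hval : ∀ n, ∫ ω, X n ω * X n ω ∂μ = autocov X μ 0 := fun n => by
    rw [hX.integral_mul hmean le_rfl, Nat.sub_self]
  calc ∫ ω, |X k ω * X l ω| ∂μ
      ≤ ∫ ω, (X k ω * X k ω + X l ω * X l ω) / 2 ∂μ := by
        refine integral_mono ((hX.memLp k).integrable_mul (hX.memLp l)).abs
          (((hsq k).add (hsq l)).div_const 2) fun ω => ?_
        change |X k ω * X l ω| ≤ _
        rw [abs_le]
        constructor <;> nlinarith [sq_nonneg (X k ω + X l ω), sq_nonneg (X k ω - X l ω)]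
    _ = autocov X μ 0 := by
        rw [integral_div, integral_add (hsq k) (hsq l), hval, hval]
        ring

/-- Second order structure of a centred stationary process sampled along an independent walk. -/
lemma IsSecondOrderStationary.sampled (hX : IsSecondOrderStationary X μ)
    (hXm : ∀ n, Measurable (X n)) (hmean : ∀ n, ∫ ω, X n ω ∂μ = 0) (hT : IsSamplingWalk T μ)
    (hXT : IndepFun (fun ω n => X n ω) (fun ω n => T n ω) μ) :
    IsSecondOrderStationary (sampled X T) μ ∧
      ∀ h, autocov (RandomSampling.sampled X T) μ h = ∫ ω, autocov X μ (T h ω) ∂μ := by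
  have hYm := measurable_sampled hXm hT.measurable
  have hprod : ∀ n m : ℕ, Integrable (fun ω => X (T n ω) ω * X (T m ω) ω) μ ∧
      ∫ ω, X (T n ω) ω * X (T m ω) ω ∂μ =
        ∫ ω, (∫ ω', X (T n ω) ω' * X (T m ω) ω' ∂μ) ∂μ := by
    intro n m
    have hJ : Measurable fun ω => (T n ω, T m ω) := (hT.measurable n).prodMk (hT.measurable m)
    have hW : ∀ i : ℕ × ℕ, Integrable (fun ω => X i.1 ω * X i.2 ω) μ := fun i =>
      (hX.memLp i.1).integrable_mul (hX.memLp i.2)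
    have hind : ∀ i : ℕ × ℕ, IndepFun (fun ω => X i.1 ω * X i.2 ω)
        (fun ω => (T n ω, T m ω)) μ := fun i =>
      hXT.comp (φ := fun f : ℕ → ℝ => f i.1 * f i.2) (ψ := fun f : ℕ → ℕ => (f n, f m))
        ((measurable_pi_apply i.1).mul (measurable_pi_apply i.2))
        ((measurable_pi_apply n).prodMk (measurable_pi_apply m))
    have hK := fun i : ℕ × ℕ => hX.integral_abs_mul_le hmean i.1 i.2
    exact ⟨(hasSum_integral_comp_indep hJ hW (summable_mul_real_preimage_singleton hJ
      (fun i => integral_nonneg fun _ => abs_nonneg _) hK) hind).1, integral_comp_indep hJ hW hK hind⟩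
  have hmem : ∀ n, MemLp (RandomSampling.sampled X T n) 2 μ := by
    intro n
    rw [memLp_two_iff_integrable_sq (hYm n).aestronglyMeasurable]
    refine (hprod n n).1.congr (Eventually.of_forall fun ω => ?_)
    simp only [RandomSampling.sampled, sq]
  have hYmean : ∀ n, ∫ ω, RandomSampling.sampled X T n ω ∂μ = 0 := by
    intro n
    -- The bound `1 + autocov X μ 0` comes from `|x| ≤ 1 + x²`.
    have := integral_comp_indep (μ := μ) (W := X) (J := T n) (K := 1 + autocov X μ 0)
      (hT.measurable n) (fun i => (hX.memLp i).integrable (by norm_num)) ?_ fun i =>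
        hXT.comp (φ := fun f : ℕ → ℝ => f i) (ψ := fun f : ℕ → ℕ => f n)
          (measurable_pi_apply i) (measurable_pi_apply n)
    · simp only [hmean, integral_zero] at this
      exact this
    · intro i
      have hsq := (hX.memLp i).integrable_mul (hX.memLp i)
      calc ∫ ω, |X i ω| ∂μ ≤ ∫ ω, (1 + (X i * X i) ω) ∂μ := by
            refine integral_mono ((hX.memLp i).integrable (by norm_num)).abs
              ((integrable_const 1).add hsq) fun ω => ?_
            simp only [Pi.mul_apply]
            rw [abs_le]
            constructor <;> nlinarith [sq_nonneg (X i ω + 1), sq_nonneg (X i ω - 1)]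
        _ = 1 + autocov X μ 0 := by
            rw [integral_add (integrable_const 1) hsq]
            have := hX.integral_mul hmean (le_refl i)
            rw [Nat.sub_self] at this
            simp [← this]
  have hcov : ∀ n h, cov[RandomSampling.sampled X T n, RandomSampling.sampled X T (n + h); μ] =
      ∫ ω, autocov X μ (T h ω) ∂μ := by
    intro n h
    rw [covariance_eq_sub (hmem n) (hmem (n + h)), hYmean, zero_mul, sub_zero]
    change ∫ ω, X (T n ω) ω * X (T (n + h) ω) ω ∂μ = _
    rw [(hprod n (n + h)).2]
    -- Given the walk, the covariance depends only on `T (n + h) - T n`, which has the law of `T h`.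
    have h1 := ((hT.identDistrib_sub n h).comp (u := autocov X μ) measurable_from_top).integral_eq
    simp only [Function.comp_def] at h1
    rw [← h1]
    refine integral_congr_ae ?_
    filter_upwards [hT.ae_strictMono] with ω hω
    exact hX.integral_mul hmean (hω.monotone (Nat.le_add_right n h))
  refine ⟨⟨hmem, fun n => by rw [hYmean, hYmean], fun n h => ?_⟩, fun h => ?_⟩
  · have := hcov 0 h
    rw [zero_add] at this
    rw [hcov, this]
  · have := hcov 0 h
    rwa [zero_add] at this

end Sampled

/-! ### Laplace transform of a step and negative moments of the walk -/

section StepLaplace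

variable {Ω : Type*} [MeasurableSpace Ω] {μ : Measure Ω} {T : ℕ → Ω → ℕ}

/-- The Laplace transform of the first step of a walk. -/
noncomputable def stepLaplace (T : ℕ → Ω → ℕ) (μ : Measure Ω) (s : ℝ) : ℝ :=
  ∫ ω, Real.exp (-(s * (T 1 ω : ℝ))) ∂μ

lemma integrable_exp_neg_mul [IsProbabilityMeasure μ] (hT : IsSamplingWalk T μ) (h : ℕ) {s : ℝ}
    (hs : 0 ≤ s) : Integrable (fun ω => Real.exp (-(s * (T h ω : ℝ)))) μ := by
  have hm := hT.measurable h
  refine Integrable.of_bound (by fun_prop) 1 (Eventually.of_forall fun ω => ?_)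
  rw [Real.norm_of_nonneg (Real.exp_nonneg _), Real.exp_le_one_iff]
  have : 0 ≤ s * (T h ω : ℝ) := by positivity
  linarith

lemma IsSamplingWalk.measurable_step (hT : IsSamplingWalk T μ) (i : ℕ) :
    Measurable fun ω => (T (i + 1) ω : ℝ) - (T i ω : ℝ) := by
  have h1 := hT.measurable (i + 1)
  have h2 := hT.measurable i
  fun_prop

lemma IsSamplingWalk.iIndepFun_step (hT : IsSamplingWalk T μ) :
    iIndepFun (fun (i : ℕ) ω => (T (i + 1) ω : ℝ) - (T i ω : ℝ)) μ := by
  have := hT.indep.comp (fun _ => fun z : ℤ => (z : ℝ)) fun _ => measurable_from_top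
  simpa [Function.comp_def] using this

lemma IsSamplingWalk.identDistrib_step (hT : IsSamplingWalk T μ) (i : ℕ) :
    IdentDistrib (fun ω => (T (i + 1) ω : ℝ) - (T i ω : ℝ))
      (fun ω => (T (0 + 1) ω : ℝ) - (T 0 ω : ℝ)) μ μ := by
  have := (hT.identDistrib i).comp (u := fun z : ℤ => (z : ℝ)) measurable_from_top
  simpa [Function.comp_def] using this

lemma IsSamplingWalk.sum_range_step_real (hT : IsSamplingWalk T μ) (h : ℕ) (ω : Ω) :
    ∑ i ∈ Finset.range h, ((T (i + 1) ω : ℝ) - (T i ω : ℝ)) = T h ω := by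
  rw [Finset.sum_range_sub (fun i => (T i ω : ℝ)) h, hT.zero]
  simp

/-- `T h` is a sum of `h` independent copies of the first step, so its Laplace transform is a power.
-/
lemma integral_exp_neg_walk (hT : IsSamplingWalk T μ) (h : ℕ) (s : ℝ) :
    ∫ ω, Real.exp (-(s * (T h ω : ℝ))) ∂μ = stepLaplace T μ s ^ h := by
  have h1 := hT.iIndepFun_step.mgf_sum (t := -s) hT.measurable_step (Finset.range h)
  rw [Finset.prod_congr rfl fun i _ => mgf_congr_of_identDistrib _ _ (hT.identDistrib_step i) (-s),
    Finset.prod_const, Finset.card_range] at h1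
  simpa [mgf, Finset.sum_apply, hT.sum_range_step_real, hT.zero, stepLaplace] using h1

lemma stepLaplace_nonneg (s : ℝ) : 0 ≤ stepLaplace T μ s :=
  integral_nonneg fun _ => (Real.exp_pos _).le

variable [IsProbabilityMeasure μ]

lemma stepLaplace_le_exp_neg (hT : IsSamplingWalk T μ) {s : ℝ} (hs : 0 ≤ s) :
    stepLaplace T μ s ≤ Real.exp (-s) := by
  have h1 : stepLaplace T μ s ≤ ∫ _, Real.exp (-s) ∂μ := by
    refine integral_mono_ae (integrable_exp_neg_mul hT 1 hs) (integrable_const _) ?_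
    filter_upwards [hT.ae_le] with ω hω
    refine Real.exp_le_exp.2 (neg_le_neg ?_)
    exact le_mul_of_one_le_right hs (by exact_mod_cast hω 1)
  simpa using h1

lemma hasSum_one_sub_stepLaplace (hT : IsSamplingWalk T μ) {s : ℝ} (hs : 0 ≤ s) :
    HasSum (fun j : ℕ => (1 - Real.exp (-(s * j))) * μ.real {ω | T 1 ω = j})
      (1 - stepLaplace T μ s) := by
  have hb : ∀ j : ℕ, 0 ≤ 1 - Real.exp (-(s * j)) := fun j => by
    rw [sub_nonneg, Real.exp_le_one_iff]
    have : 0 ≤ s * (j : ℝ) := by positivity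
    linarith
  have h1 := (hasSum_integral_comp (μ := μ) (hT.measurable 1)
    (a := fun j : ℕ => 1 - Real.exp (-(s * j)))
    (summable_mul_real_preimage_singleton (K := 1) (hT.measurable 1) (fun _ => abs_nonneg _)
      fun j => by rw [abs_of_nonneg (hb j)]; linarith [Real.exp_pos (-(s * (j : ℝ)))])).2
  rw [integral_sub (integrable_const _) (integrable_exp_neg_mul hT 1 hs)] at h1
  simpa [stepLaplace, Set.preimage] using h1

/-- A heavy lower tail of the steps makes the Laplace transform small. -/
lemma exists_stepLaplace_le (hT : IsSamplingWalk T μ) {γ c : ℝ} (hγ1 : 1 < γ) (hγ2 : γ ≤ 2)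
    (hc : 0 < c)
    (hS : ∀ᶠ j : ℕ in atTop, c * (j : ℝ) ^ (-γ) ≤ μ.real {ω | T 1 ω = j}) :
    ∃ c' : ℝ, 0 < c' ∧ ∀ s : ℝ, 0 < s → stepLaplace T μ s ≤ Real.exp (-c' * s ^ (γ - 1)) := by
  obtain ⟨N, hN⟩ := eventually_atTop.1 hS
  set c' : ℝ := (1 - Real.exp (-1)) * (c * 2 ^ (-γ)) * ((N : ℝ) + 2) ^ (-(γ - 1)) with hc'
  have he : 0 < 1 - Real.exp (-1) := by
    rw [sub_pos, Real.exp_lt_one_iff]; norm_num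
  have hc'0 : 0 < c' := by rw [hc']; positivity
  have hsmall : ∀ s : ℝ, 0 < s → s ≤ 1 → c' * s ^ (γ - 1) ≤ 1 - stepLaplace T μ s := by
    intro s hs hs1
    -- This `n` is of order `1/s`, beyond the threshold `N`. For `n ≤ j < 2n` one has `s j ≥ 1` and
    -- mass at least `c (2n)^(-γ)`; these `n` terms contribute order `n^(1-γ)`, and `n ≤ (N+2)/s`
    -- gives `c'`.
    set n : ℕ := N + 1 + ⌊1 / s⌋₊ with hn
    have hn1 : 1 / s ≤ n := by
      have := (Nat.lt_floor_add_one (1 / s)).le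
      rw [hn]; push_cast; linarith [Nat.cast_nonneg (α := ℝ) N]
    have hn0 : (0 : ℝ) < n := lt_of_lt_of_le (by positivity) hn1
    have hn2 : (n : ℝ) ≤ ((N : ℝ) + 2) / s := by
      have h1 := Nat.floor_le (by positivity : 0 ≤ 1 / s)
      have h2 : (N : ℝ) + 1 ≤ ((N : ℝ) + 1) / s := le_div_self (by positivity) hs hs1
      rw [hn]; push_cast
      calc (N : ℝ) + 1 + ⌊1 / s⌋₊ ≤ ((N : ℝ) + 1) / s + 1 / s := add_le_add h2 h1
        _ = _ := by ring
    have hsum := sum_le_hasSum (Finset.Ico n (2 * n)) (fun j _ => mul_nonneg (by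
      rw [sub_nonneg, Real.exp_le_one_iff]
      have : 0 ≤ s * (j : ℝ) := by positivity
      linarith) measureReal_nonneg) (hasSum_one_sub_stepLaplace hT hs.le)
    refine le_trans ?_ hsum
    have hterm : ∀ j ∈ Finset.Ico n (2 * n), (1 - Real.exp (-1)) * (c * (2 * (n : ℝ)) ^ (-γ)) ≤
        (1 - Real.exp (-(s * j))) * μ.real {ω | T 1 ω = j} := by
      intro j hj
      obtain ⟨hj1, hj2⟩ := Finset.mem_Ico.1 hj
      have hj1' : (n : ℝ) ≤ j := by exact_mod_cast hj1
      have hj2' : (j : ℝ) ≤ 2 * n := by exact_mod_cast hj2.le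
      have hsj : 1 ≤ s * j := by
        calc 1 = s * (1 / s) := by field_simp
          _ ≤ s * j := by gcongr; exact hn1.trans hj1'
      refine mul_le_mul ?_ ((mul_le_mul_of_nonneg_left
        (Real.rpow_le_rpow_of_nonpos (hn0.trans_le hj1') hj2' (by linarith)) hc.le).trans
          (hN j (by omega))) (by positivity) ?_
      · gcongr
      · rw [sub_nonneg, Real.exp_le_one_iff]; linarith
    refine le_trans ?_ (Finset.card_nsmul_le_sum _ _ _ hterm)
    rw [Nat.card_Ico, nsmul_eq_mul, show 2 * n - n = n by omega]
    have e1 : (n : ℝ) * (2 * (n : ℝ)) ^ (-γ) = 2 ^ (-γ) * (n : ℝ) ^ (-(γ - 1)) := by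
      rw [Real.mul_rpow (by norm_num) hn0.le, show -(γ - 1) = 1 + -γ by ring,
        Real.rpow_add hn0, Real.rpow_one]
      ring
    have e2 : ((N : ℝ) + 2) ^ (-(γ - 1)) * s ^ (γ - 1) ≤ (n : ℝ) ^ (-(γ - 1)) := by
      calc ((N : ℝ) + 2) ^ (-(γ - 1)) * s ^ (γ - 1) = (((N : ℝ) + 2) / s) ^ (-(γ - 1)) := by
            rw [Real.div_rpow (by positivity) hs.le, Real.rpow_neg hs.le, div_inv_eq_mul]
        _ ≤ _ := Real.rpow_le_rpow_of_nonpos hn0 hn2 (by linarith)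
    calc c' * s ^ (γ - 1) = (1 - Real.exp (-1)) * (c * 2 ^ (-γ)) *
          (((N : ℝ) + 2) ^ (-(γ - 1)) * s ^ (γ - 1)) := by rw [hc']; ring
      _ ≤ (1 - Real.exp (-1)) * (c * 2 ^ (-γ)) * (n : ℝ) ^ (-(γ - 1)) := by gcongr
      _ = (1 - Real.exp (-1)) * c * (2 ^ (-γ) * (n : ℝ) ^ (-(γ - 1))) := by ring
      _ = _ := by rw [← e1]; ring
  -- Needed for `s ≥ 1`, where `φ(s) ≤ exp(-s)` because steps are at least one, and `c' s^(γ-1) ≤ s`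
  -- because `γ ≤ 2`.
  have hc'1 : c' ≤ 1 := by
    have := hsmall 1 one_pos le_rfl
    rw [Real.one_rpow, mul_one] at this
    linarith [stepLaplace_nonneg (T := T) (μ := μ) 1]
  refine ⟨c', hc'0, fun s hs => ?_⟩
  rcases le_total s 1 with hs1 | hs1
  · have h1 := hsmall s hs hs1
    have h2 := Real.add_one_le_exp (-c' * s ^ (γ - 1))
    linarith
  · refine (stepLaplace_le_exp_neg hT hs.le).trans (Real.exp_le_exp.2 ?_)
    have h1 : s ^ (γ - 1) ≤ s := Real.rpow_le_self_of_one_le hs1 (by linarith)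
    have h2 : c' * s ^ (γ - 1) ≤ 1 * s := by gcongr
    linarith

lemma integrableOn_rpow_mul_min {a : ℝ} (ha0 : 0 < a) (ha1 : a < 1) :
    IntegrableOn (fun x : ℝ => x ^ (-1 - a) * min 1 x) (Set.Ioi 0) := by
  have hm : Measurable fun x : ℝ => x ^ (-1 - a) * min 1 x := by fun_prop
  rw [← Set.Ioc_union_Ioi_eq_Ioi zero_le_one]
  refine IntegrableOn.union ?_ ?_
  · have h1 : IntegrableOn (fun x : ℝ => x ^ (-a)) (Set.Ioc 0 1) := by
      have := intervalIntegral.intervalIntegrable_rpow' (a := 0) (b := 1)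
        (by linarith : -1 < -a)
      rwa [intervalIntegrable_iff_integrableOn_Ioc_of_le zero_le_one] at this
    refine h1.congr_fun (fun x hx => ?_) measurableSet_Ioc
    have hx0 : 0 < x := hx.1
    simp only [min_eq_right hx.2]
    rw [show -a = (-1 - a) + 1 by ring, Real.rpow_add hx0, Real.rpow_one]
  · refine (integrableOn_Ioi_rpow_of_lt (by linarith : -1 - a < -1) one_pos).congr_fun
      (fun x hx => ?_) measurableSet_Ioi
    simp only [min_eq_left (le_of_lt (Set.mem_Ioi.1 hx)), mul_one]

/-- A light upper tail of the steps keeps the Laplace transform close to one near zero. -/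
lemma exists_one_sub_stepLaplace_le (hT : IsSamplingWalk T μ) {a K : ℝ} (ha0 : 0 < a) (ha1 : a < 1)
    (hS : ∀ j : ℕ, 1 ≤ j → μ.real {ω | T 1 ω = j} ≤ K * (j : ℝ) ^ (-1 - a)) :
    ∃ C : ℝ, 1 ≤ C ∧ ∀ s : ℝ, 0 < s → 1 - stepLaplace T μ s ≤ C * s ^ a := by
  set I : ℝ := ∫ x in Set.Ioi (0 : ℝ), x ^ (-1 - a) * min 1 x with hI
  have hK0 : 0 ≤ K := by simpa using measureReal_nonneg.trans (hS 1 le_rfl)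
  refine ⟨max 1 (K * I), le_max_left _ _, fun s hs => ?_⟩
  -- From `1 - exp(-x) ≤ min 1 x`, the term of index `j` is at most `K * m j`. As `m` decreases, its
  -- sum is at most its integral, which scales as `s^a`. The condition `a < 1` makes the integral
  -- converge at `0`.
  set m : ℝ → ℝ := fun x => x ^ (-1 - a) * min 1 (s * x) with hm
  have hm_scale : ∀ x ∈ Set.Ioi (0 : ℝ),
      m x = s ^ (1 + a) * ((s * x) ^ (-1 - a) * min 1 (s * x)) := by
    intro x hx
    have hx0 : (0 : ℝ) < x := hx
    rw [hm, Real.mul_rpow hs.le hx0.le, show (-1 - a) = -(1 + a) by ring, Real.rpow_neg hs.le]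
    have : s ^ (1 + a) ≠ 0 := by positivity
    field_simp
  have hm_int : IntegrableOn m (Set.Ioi 0) := by
    have h1 := (integrableOn_Ioi_comp_mul_left_iff (fun x : ℝ => x ^ (-1 - a) * min 1 x) 0 hs).2
      (by simpa using integrableOn_rpow_mul_min ha0 ha1)
    exact IntegrableOn.congr_fun (h1.const_mul (s ^ (1 + a))) (fun x hx => (hm_scale x hx).symm)
      measurableSet_Ioi
  have hm_val : ∫ x in Set.Ioi (0 : ℝ), m x = s ^ a * I := by
    rw [setIntegral_congr_fun measurableSet_Ioi hm_scale, integral_const_mul,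
      integral_comp_mul_left_Ioi (fun x : ℝ => x ^ (-1 - a) * min 1 x) 0 hs, mul_zero, ← hI,
      Real.rpow_add hs, Real.rpow_one, smul_eq_mul]
    field_simp
  have hm_anti : ∀ x y : ℝ, 0 < x → x ≤ y → m y ≤ m x := by
    intro x y hx hxy
    have hy : 0 < y := hx.trans_le hxy
    have e : ∀ z : ℝ, 0 < z → m z = min (z ^ (-1 - a)) (s * z ^ (-a)) := by
      intro z hz
      have : z ^ (-a) = z ^ (-1 - a) * z := by
        rw [show -a = (-1 - a) + 1 by ring, Real.rpow_add hz, Real.rpow_one]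
      rw [hm, this]; dsimp only
      rw [mul_min_of_nonneg _ _ (by positivity), mul_one]
      congr 1; ring
    rw [e x hx, e y hy]
    gcongr min ?_ (s * ?_)
    · exact Real.rpow_le_rpow_of_nonpos hx hxy (by linarith)
    · exact Real.rpow_le_rpow_of_nonpos hx hxy (by linarith)
  have hm_nonneg : ∀ x : ℝ, 0 < x → 0 ≤ m x := fun x hx => by
    rw [hm]; positivity
  have hsummable : Summable fun n : ℕ => m ((n : ℝ) + 1) := by
    have h1 : Summable fun n : ℕ => ((n : ℝ) + 1) ^ (-1 - a) := by
      have := (summable_nat_add_iff 1).2 (Real.summable_nat_rpow.2 (by linarith : -1 - a < -1))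
      simpa using this
    refine Summable.of_nonneg_of_le (fun n => hm_nonneg _ (by positivity)) (fun n => ?_) h1
    exact mul_le_of_le_one_right (by positivity) (min_le_left _ _)
  have htsum : ∑' n : ℕ, m ((n : ℝ) + 1) ≤ s ^ a * I := by
    rw [← integral_Ioi_floor_eq_tsum hsummable, ← hm_val]
    refine integral_mono_of_nonneg ?_ hm_int ?_
    · exact Eventually.of_forall fun x => hm_nonneg _ (by positivity)
    · filter_upwards [ae_restrict_mem measurableSet_Ioi] with x hx
      exact hm_anti _ _ hx (Nat.lt_floor_add_one x).le
  -- The term `j = 0` vanishes, so the sum may start at `1`, where the tail bound holds.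
  have h1 := (hasSum_nat_add_iff' 1).2 (hasSum_one_sub_stepLaplace hT hs.le)
  simp only [Finset.sum_range_one, Nat.cast_zero, mul_zero, neg_zero, Real.exp_zero, sub_self,
    zero_mul, sub_zero, Nat.cast_add, Nat.cast_one] at h1
  have h2 : 1 - stepLaplace T μ s ≤ ∑' n : ℕ, K * m ((n : ℝ) + 1) := by
    refine hasSum_le (fun n => ?_) h1 (hsummable.mul_left K).hasSum
    have hn : (0 : ℝ) < (n : ℝ) + 1 := by positivity
    have h3 : 1 - Real.exp (-(s * ((n : ℝ) + 1))) ≤ min 1 (s * ((n : ℝ) + 1)) := by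
      refine le_min (by linarith [Real.exp_pos (-(s * ((n : ℝ) + 1)))]) ?_
      linarith [Real.add_one_le_exp (-(s * ((n : ℝ) + 1)))]
    have h4 := hS (n + 1) (by omega)
    push_cast at h4
    calc _ ≤ min 1 (s * ((n : ℝ) + 1)) * (K * ((n : ℝ) + 1) ^ (-1 - a)) :=
          mul_le_mul h3 h4 measureReal_nonneg (by positivity)
      _ = _ := by rw [hm]; ring
  rw [tsum_mul_left] at h2
  calc 1 - stepLaplace T μ s ≤ K * (s ^ a * I) := h2.trans (by gcongr)
    _ = (K * I) * s ^ a := by ring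
    _ ≤ _ := by gcongr; exact le_max_right _ _

lemma integrable_walk_rpow_neg (hT : IsSamplingWalk T μ) {b : ℝ} (hb : 0 < b) {h : ℕ}
    (hh : 1 ≤ h) : Integrable (fun ω => (T h ω : ℝ) ^ (-b)) μ := by
  have hm := hT.measurable h
  refine Integrable.of_bound
    ((measurable_from_top (f := fun k : ℕ => (k : ℝ) ^ (-b))).comp hm).aestronglyMeasurable 1 ?_
  filter_upwards [hT.ae_le] with ω hω
  rw [Real.norm_of_nonneg (by positivity)]
  exact Real.rpow_le_one_of_one_le_of_nonpos (by exact_mod_cast hh.trans (hω h)) (by linarith)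

/-- Upper bound for the negative moments of a heavy-tailed walk. -/
lemma exists_integral_walk_rpow_neg_le (hT : IsSamplingWalk T μ) {a b c : ℝ} (ha : 0 < a)
    (hb : 0 < b) (hc : 0 < c)
    (hφ : ∀ s : ℝ, 0 < s → stepLaplace T μ s ≤ Real.exp (-c * s ^ a)) :
    ∃ C : ℝ, 0 < C ∧ ∀ h : ℕ, 1 ≤ h → ∫ ω, (T h ω : ℝ) ^ (-b) ∂μ ≤ C * (h : ℝ) ^ (-b / a) := by
  have hΓ := Real.Gamma_pos_of_pos hb
  refine ⟨(Real.Gamma b)⁻¹ * (c ^ (-b / a) * (1 / a) * Real.Gamma (b / a)), by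
    have := Real.Gamma_pos_of_pos (div_pos hb ha)
    positivity, fun h hh => ?_⟩
  have hh0 : (0 : ℝ) < h := by exact_mod_cast hh
  have hm := hT.measurable h
  have hTpos : ∀ᵐ ω ∂μ, (0 : ℝ) < T h ω := by
    filter_upwards [hT.ae_le] with ω hω
    exact_mod_cast hh.trans (hω h)
  have hval : ∀ t : ℝ, 0 < t →
      -- The Gamma integral writes `t^(-b)` as a mixture of exponentials, so that the moment of `T
      -- h` reduces to powers of `φ`.
      ∫ s in Set.Ioi (0 : ℝ), s ^ (b - 1) * Real.exp (-(s * t)) = Real.Gamma b * t ^ (-b) := by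
    intro t ht
    have := Real.integral_rpow_mul_exp_neg_mul_Ioi hb ht
    simp only [mul_comm t] at this
    rw [this, one_div, Real.inv_rpow ht.le, Real.rpow_neg ht.le, mul_comm]
  have hF : Integrable (Function.uncurry fun (ω : Ω) (s : ℝ) =>
      s ^ (b - 1) * Real.exp (-(s * (T h ω : ℝ)))) (μ.prod (volume.restrict (Set.Ioi 0))) := by
    rw [integrable_prod_iff]
    · constructor
      · filter_upwards [hTpos] with ω hω
        have := integrableOn_rpow_mul_exp_neg_mul_rpow (p := 1) (s := b - 1) (by linarith)
          one_pos hω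
        simpa [IntegrableOn, mul_comm] using this
      · refine ((integrable_walk_rpow_neg hT hb hh).const_mul (Real.Gamma b)).congr ?_
        filter_upwards [hTpos] with ω hω
        rw [← hval _ hω]
        refine setIntegral_congr_fun measurableSet_Ioi fun s hs => ?_
        have hs0 : (0 : ℝ) < s := hs
        simp only [Function.uncurry]
        rw [Real.norm_of_nonneg (by positivity)]
    · refine Measurable.aestronglyMeasurable ?_
      have : Measurable fun z : Ω × ℝ => (T h z.1 : ℝ) :=
        measurable_from_top.comp (hm.comp measurable_fst)
      simp only [Function.uncurry_def]
      fun_prop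
  have hswap := integral_integral_swap hF
  have hleft : ∫ ω, (∫ s in Set.Ioi (0 : ℝ), s ^ (b - 1) * Real.exp (-(s * (T h ω : ℝ)))) ∂μ =
      Real.Gamma b * ∫ ω, (T h ω : ℝ) ^ (-b) ∂μ := by
    rw [← integral_const_mul]
    refine integral_congr_ae ?_
    filter_upwards [hTpos] with ω hω using hval _ hω
  have hright : ∫ s in Set.Ioi (0 : ℝ), (∫ ω, s ^ (b - 1) * Real.exp (-(s * (T h ω : ℝ))) ∂μ) ≤
      ∫ s in Set.Ioi (0 : ℝ), s ^ (b - 1) * Real.exp (-(c * h) * s ^ a) := by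
    refine integral_mono_of_nonneg ?_
      (integrableOn_rpow_mul_exp_neg_mul_rpow (by linarith) ha (by positivity)) ?_
    · filter_upwards [ae_restrict_mem measurableSet_Ioi] with s hs
      have hs0 : (0 : ℝ) < s := hs
      exact integral_nonneg fun ω => by positivity
    · filter_upwards [ae_restrict_mem measurableSet_Ioi] with s hs
      have hs0 : (0 : ℝ) < s := hs
      rw [integral_const_mul, integral_exp_neg_walk hT]
      gcongr
      calc stepLaplace T μ s ^ h ≤ Real.exp (-c * s ^ a) ^ h := by
            gcongr
            · exact stepLaplace_nonneg s
            · exact hφ s hs0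
        _ = _ := by rw [← Real.exp_nat_mul]; congr 1; ring
  rw [← hswap, hleft, integral_rpow_mul_exp_neg_mul_rpow ha (by linarith) (by positivity),
    sub_add_cancel, Real.mul_rpow hc.le hh0.le] at hright
  calc ∫ ω, (T h ω : ℝ) ^ (-b) ∂μ = (Real.Gamma b)⁻¹ *
        (Real.Gamma b * ∫ ω, (T h ω : ℝ) ^ (-b) ∂μ) := by field_simp
    _ ≤ (Real.Gamma b)⁻¹ * (c ^ (-b / a) * (h : ℝ) ^ (-b / a) * (1 / a) * Real.Gamma (b / a)) := by
        gcongr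
    _ = _ := by ring

/-- Lower bound for the negative moments of a walk with controlled tails. -/
lemma exists_le_integral_walk_rpow_neg (hT : IsSamplingWalk T μ) {a b C : ℝ} (ha : 0 < a)
    (hb0 : 0 < b) (hb1 : b ≤ 1) (hC : 1 ≤ C)
    (hφ : ∀ s : ℝ, 0 < s → 1 - stepLaplace T μ s ≤ C * s ^ a) :
    ∃ c : ℝ, 0 < c ∧ ∀ h : ℕ, 1 ≤ h → c * (h : ℝ) ^ (-b / a) ≤ ∫ ω, (T h ω : ℝ) ^ (-b) ∂μ := by
  refine ⟨(2 * C) ^ (-b / a) / 2, by positivity, fun h hh => ?_⟩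
  have hh0 : (0 : ℝ) < h := by exact_mod_cast hh
  -- Chosen so that `C s^a = 1/(2h)`; Bernoulli's inequality then keeps `φ(s)^h` above `1/2`.
  set s : ℝ := (2 * C * h) ^ (-a⁻¹) with hs
  have hbase : 0 < 2 * C * (h : ℝ) := by positivity
  have hs0 : 0 < s := by positivity
  have hsa : s ^ a = (2 * C * h)⁻¹ := by
    rw [hs, ← Real.rpow_mul hbase.le, neg_mul, inv_mul_cancel₀ ha.ne', Real.rpow_neg_one]
  have hsb : s ^ b = (2 * C) ^ (-b / a) * (h : ℝ) ^ (-b / a) := by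
    rw [hs, ← Real.rpow_mul hbase.le, ← Real.mul_rpow (by positivity) hh0.le]
    congr 1
    field_simp
  have hφs : 1 - 1 / (2 * h) ≤ stepLaplace T μ s := by
    have := hφ s hs0
    rw [hsa, show C * (2 * C * (h : ℝ))⁻¹ = 1 / (2 * h) by field_simp] at this
    linarith
  have hh1 : (1 : ℝ) ≤ h := by exact_mod_cast hh
  have hq : 1 / (2 * (h : ℝ)) ≤ 1 / 2 := by
    rw [div_le_div_iff₀ (by positivity) (by norm_num)]
    linarith
  have hpow : 1 / 2 ≤ stepLaplace T μ s ^ h := by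
    calc (1 : ℝ) / 2 = 1 + h * (-(1 / (2 * h))) := by field_simp; ring
      _ ≤ (1 + -(1 / (2 * (h : ℝ)))) ^ h := one_add_mul_le_pow (by linarith) h
      _ ≤ stepLaplace T μ s ^ h := by
        gcongr
        · linarith
        · linarith
  have hpt : s ^ b * stepLaplace T μ s ^ h ≤ ∫ ω, (T h ω : ℝ) ^ (-b) ∂μ := by
    rw [← integral_exp_neg_walk hT, ← integral_const_mul]
    refine integral_mono_ae ((integrable_exp_neg_mul hT h hs0.le).const_mul _)
      (integrable_walk_rpow_neg hT hb0 hh) ?_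
    filter_upwards [hT.ae_le] with ω hω
    have hT1 : (1 : ℝ) ≤ T h ω := by exact_mod_cast hh.trans (hω h)
    have hT0 : (0 : ℝ) < T h ω := by linarith
    -- The inequality `x^b ≤ exp x` for `0 < b ≤ 1` is equivalent to `T^(-b) ≥ s^b exp(-s T)`.
    have hx : (s * (T h ω : ℝ)) ^ b ≤ Real.exp (s * (T h ω : ℝ)) := by
      rcases le_total (s * (T h ω : ℝ)) 1 with h1 | h1
      · exact (Real.rpow_le_one (by positivity) h1 hb0.le).trans
          (Real.one_le_exp (by positivity))
      · refine (Real.rpow_le_self_of_one_le h1 hb1).trans ?_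
        linarith [Real.add_one_le_exp (s * (T h ω : ℝ))]
    rw [Real.mul_rpow hs0.le hT0.le] at hx
    rw [Real.exp_neg, Real.rpow_neg hT0.le, ← div_eq_mul_inv, div_le_iff₀ (Real.exp_pos _),
      inv_mul_eq_div, le_div_iff₀ (by positivity)]
    exact hx
  calc _ = s ^ b * (1 / 2) := by rw [hsb]; ring
    _ ≤ s ^ b * stepLaplace T μ s ^ h := by gcongr
    _ ≤ _ := hpt

/-- Integrable steps obey the law of large numbers. -/
lemma IsSamplingWalk.exists_tendsto_div (hT : IsSamplingWalk T μ)
    (hint : Integrable (fun ω => (T 1 ω : ℝ)) μ) :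
    ∃ m : ℝ, 0 < m ∧ ∀ᵐ ω ∂μ, Tendsto (fun n : ℕ => (T n ω : ℝ) / n) atTop (𝓝 m) := by
  have h1 := strong_law_ae_real (μ := μ) (fun (i : ℕ) ω => (T (i + 1) ω : ℝ) - (T i ω : ℝ))
    (by simpa [hT.zero] using hint) (fun i j hij => hT.iIndepFun_step.indepFun hij)
    hT.identDistrib_step
  simp only [hT.sum_range_step_real] at h1
  refine ⟨_, ?_, h1⟩
  -- The limit is at least `1`, since `T n ≥ n` almost surely.
  obtain ⟨ω, hω1, hω2⟩ := (h1.and hT.ae_le).exists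
  refine lt_of_lt_of_le one_pos (ge_of_tendsto hω1 ?_)
  filter_upwards [eventually_gt_atTop 0] with n hn
  have : (0 : ℝ) < n := by exact_mod_cast hn
  rw [le_div_iff₀ this, one_mul]
  exact_mod_cast hω2 n

end StepLaplace

/-! ### From covariance bounds to memory properties -/

section Memory

variable {Ω : Type*} [MeasurableSpace Ω] {μ : Measure Ω} {Z : ℕ → Ω → ℝ}

lemma eventually_le_mul_rpow_nat (C : ℝ) {ε : ℝ} (hε : 0 < ε) :
    ∀ᶠ h : ℕ in atTop, C ≤ (h : ℝ) ^ ε :=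
  ((tendsto_rpow_atTop hε).comp tendsto_natCast_atTop_atTop).eventually_ge_atTop C

/-- Half of `ε` is spent on the assumed lower bound, the other half absorbs `c`; on the upper side
`h^ε` absorbs `C`. -/
lemma hasMemoryParameter_of_bounds {δ c C : ℝ} (hc : 0 < c)
    (hl : ∀ ε : ℝ, 0 < ε → ∀ᶠ h : ℕ in atTop, c * (h : ℝ) ^ (2 * δ - 1 - ε) ≤ autocov Z μ h)
    (hu : ∀ h : ℕ, 1 ≤ h → |autocov Z μ h| ≤ C * (h : ℝ) ^ (2 * δ - 1)) :
    HasMemoryParameter Z μ δ := by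
  intro ε hε
  filter_upwards [hl (ε / 2) (by positivity), eventually_le_mul_rpow_nat c⁻¹ (half_pos hε),
    eventually_le_mul_rpow_nat C hε, eventually_ge_atTop 1] with h h1 h2 h3 hh
  have hh0 : (0 : ℝ) < h := by exact_mod_cast hh
  constructor
  · refine le_trans ?_ (h1.trans (le_abs_self _))
    have e : (h : ℝ) ^ (2 * δ - 1 - ε / 2) = (h : ℝ) ^ (2 * δ - 1 - ε) * (h : ℝ) ^ (ε / 2) := by
      rw [← Real.rpow_add hh0]; congr 1; ring
    rw [e]
    calc (h : ℝ) ^ (2 * δ - 1 - ε) = c * ((h : ℝ) ^ (2 * δ - 1 - ε) * c⁻¹) := by field_simp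
      _ ≤ _ := by gcongr
  · refine (hu h hh).trans ?_
    rw [Real.rpow_add hh0, mul_comm]
    gcongr

lemma hasLongMemory_of_le {e c : ℝ} (hc : 0 < c) (he : -1 ≤ e)
    (hl : ∀ᶠ h : ℕ in atTop, c * (h : ℝ) ^ e ≤ autocov Z μ h) : HasLongMemory Z μ := by
  intro hs
  have h1 : Summable fun h : ℕ => (h : ℝ) ^ e := by
    refine Summable.of_norm_bounded_eventually_nat (hs.mul_left c⁻¹) ?_
    filter_upwards [hl] with h hh
    rw [Real.norm_of_nonneg (by positivity), inv_mul_eq_div, le_div_iff₀ hc, mul_comm]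
    exact hh.trans (le_abs_self _)
  exact absurd (Real.summable_nat_rpow.1 h1) (not_lt.2 he)

lemma eventually_half_mul_rpow_le {C b : ℝ} (hC : 0 < C) {u : ℕ → ℝ}
    (hu : Tendsto (fun h : ℕ => u h * (h : ℝ) ^ b) atTop (𝓝 C)) :
    ∀ᶠ h : ℕ in atTop, C / 2 * (h : ℝ) ^ (-b) ≤ u h := by
  filter_upwards [hu.eventually_const_le (half_lt_self hC), eventually_gt_atTop 0] with h h1 hh
  have hh0 : (0 : ℝ) < h := by exact_mod_cast hh
  rw [Real.rpow_neg hh0.le, ← div_eq_mul_inv, div_le_iff₀ (by positivity)]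
  exact h1

lemma exists_abs_le_rpow_neg_of_tendsto {L b : ℝ} (hb : 0 ≤ b) {u : ℕ → ℝ}
    (hu : Tendsto (fun h : ℕ => u h * (h : ℝ) ^ b) atTop (𝓝 L)) :
    ∃ K : ℝ, 0 ≤ K ∧ ∀ h : ℕ, 1 ≤ h → |u h| ≤ K * (h : ℝ) ^ (-b) := by
  obtain ⟨K, hK0, hK⟩ := exists_abs_le_of_tendsto_mul_rpow hb hu
  refine ⟨K, hK0, fun h hh => (hK h).trans ?_⟩
  have hh0 : (0 : ℝ) < h := by exact_mod_cast hh
  gcongr ?_ * ?_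
  exact Real.rpow_le_rpow_of_nonpos hh0 (by linarith) (by linarith)

/-- Regular decay of index `2 d - 1` of the covariances gives long memory with parameter `d`. -/
lemma longMemory_of_tendsto {C d : ℝ} (hd0 : 0 < d) (hd1 : d < 1 / 2) (hC : 0 < C)
    (hu : Tendsto (fun h : ℕ => autocov Z μ h * (h : ℝ) ^ (1 - 2 * d)) atTop (𝓝 C)) :
    HasLongMemory Z μ ∧ HasMemoryParameter Z μ d := by
  have hl := eventually_half_mul_rpow_le hC hu
  obtain ⟨K, -, hK⟩ := exists_abs_le_rpow_neg_of_tendsto (by linarith) hu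
  rw [neg_sub] at hl hK
  refine ⟨hasLongMemory_of_le (half_pos hC) (by linarith) hl,
    hasMemoryParameter_of_bounds (half_pos hC) (fun ε hε => ?_) hK⟩
  filter_upwards [hl, eventually_ge_atTop 1] with h h1 hh
  refine le_trans ?_ h1
  have hh1 : (1 : ℝ) ≤ h := by exact_mod_cast hh
  exact mul_le_mul_of_nonneg_left (Real.rpow_le_rpow_of_exponent_le hh1 (by linarith))
    (half_pos hC).le

lemma isEquivalent_const_mul_rpow {C b : ℝ} (hC : 0 < C) {u : ℕ → ℝ}
    (hu : Tendsto (fun h : ℕ => u h * (h : ℝ) ^ (-b)) atTop (𝓝 C)) :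
    u ~[atTop] fun h : ℕ => C * (h : ℝ) ^ b := by
  refine isEquivalent_of_tendsto_one ?_
  have h1 := hu.div_const C
  rw [div_self hC.ne'] at h1
  refine h1.congr fun h => ?_
  rw [Pi.div_apply, Real.rpow_neg (Nat.cast_nonneg h)]
  field_simp

lemma hasShortMemory_of_le {C e : ℝ} (he : e < -1)
    (hu : ∀ h : ℕ, 1 ≤ h → |autocov Z μ h| ≤ C * (h : ℝ) ^ e) : HasShortMemory Z μ := by
  refine Summable.of_norm_bounded_eventually_nat ((Real.summable_nat_rpow.2 he).mul_left C) ?_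
  filter_upwards [eventually_ge_atTop 1] with h hh
  simpa using hu h hh

end Memory

/-! ### Expectation of a decaying sequence along the walk -/

section Composition

variable {Ω : Type*} [MeasurableSpace Ω] {μ : Measure Ω} [IsProbabilityMeasure μ]
  {T : ℕ → Ω → ℕ} {u : ℕ → ℝ}

lemma abs_integral_comp_walk_le (hT : IsSamplingWalk T μ) {K b : ℝ} (hb : 0 < b)
    (hu : ∀ k : ℕ, 1 ≤ k → |u k| ≤ K * (k : ℝ) ^ (-b)) {h : ℕ} (hh : 1 ≤ h) :
    |∫ ω, u (T h ω) ∂μ| ≤ K * ∫ ω, (T h ω : ℝ) ^ (-b) ∂μ := by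
  rw [← integral_const_mul, ← Real.norm_eq_abs]
  refine norm_integral_le_of_norm_le ((integrable_walk_rpow_neg hT hb hh).const_mul K) ?_
  filter_upwards [hT.ae_le] with ω hω
  exact hu _ (hh.trans (hω h))

/-- Since `T h ≥ h` almost surely, a bound valid from `N` on applies to all values of `T h` once `h
≥ N`. -/
lemma eventually_le_integral_comp_walk (hT : IsSamplingWalk T μ) {K c b : ℝ} (hb : 0 < b)
    (hu : ∀ k : ℕ, 1 ≤ k → |u k| ≤ K * (k : ℝ) ^ (-b))
    (hl : ∀ᶠ k : ℕ in atTop, c * (k : ℝ) ^ (-b) ≤ u k) :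
    ∀ᶠ h : ℕ in atTop, c * ∫ ω, (T h ω : ℝ) ^ (-b) ∂μ ≤ ∫ ω, u (T h ω) ∂μ := by
  obtain ⟨N, hN⟩ := eventually_atTop.1 hl
  filter_upwards [eventually_ge_atTop N, eventually_ge_atTop 1] with h h1 h2
  have hi := integrable_walk_rpow_neg hT hb h2
  rw [← integral_const_mul]
  refine integral_mono_ae (hi.const_mul c) ?_ ?_
  · refine Integrable.mono' (hi.const_mul K)
      ((measurable_from_top (f := u)).comp (hT.measurable h)).aestronglyMeasurable ?_
    filter_upwards [hT.ae_le] with ω hω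
    exact hu _ (h2.trans (hω h))
  · filter_upwards [hT.ae_le] with ω hω
    exact hN _ (h1.trans (hω h))

/-- Sampling along a walk with integrable steps preserves regular decay. -/
lemma exists_tendsto_integral_comp_walk (hT : IsSamplingWalk T μ) {C b : ℝ} (hb : 0 < b)
    (hC : 0 < C) (hint : Integrable (fun ω => (T 1 ω : ℝ)) μ)
    (hu : Tendsto (fun k : ℕ => u k * (k : ℝ) ^ b) atTop (𝓝 C)) :
    ∃ C' : ℝ, 0 < C' ∧
      Tendsto (fun h : ℕ => (∫ ω, u (T h ω) ∂μ) * (h : ℝ) ^ b) atTop (𝓝 C') := by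
  obtain ⟨m, hm, hlim⟩ := hT.exists_tendsto_div hint
  obtain ⟨K, hK0, hK⟩ := exists_abs_le_of_tendsto_mul_rpow hb.le hu
  refine ⟨C * m ^ (-b), by positivity, ?_⟩
  have h1 : Tendsto (fun h : ℕ => ∫ ω, u (T h ω) * (h : ℝ) ^ b ∂μ) atTop
      (𝓝 (∫ _, C * m ^ (-b) ∂μ)) := by
    -- Because `T h ≥ h`, the decay of `u (T h)` compensates `h^b` and a constant dominates.
    refine tendsto_integral_of_dominated_convergence (fun _ => K) ?_ (integrable_const _) ?_ ?_
    · intro h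
      exact (((measurable_from_top (f := u)).comp (hT.measurable h)).mul_const
        _).aestronglyMeasurable
    · intro h
      filter_upwards [hT.ae_le] with ω hω
      have hle : (h : ℝ) ≤ T h ω := by exact_mod_cast hω h
      rw [norm_mul, Real.norm_of_nonneg (by positivity : (0 : ℝ) ≤ (h : ℝ) ^ b)]
      calc ‖u (T h ω)‖ * (h : ℝ) ^ b
          ≤ (K * ((T h ω : ℝ) + 1) ^ (-b)) * ((T h ω : ℝ) + 1) ^ b := by
            gcongr
            · exact hK _
            · linarith
        _ = K := by
            rw [mul_assoc, ← Real.rpow_add (by positivity), neg_add_cancel, Real.rpow_zero,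
              mul_one]
    · filter_upwards [hlim, hT.ae_le] with ω hω hω'
      exact tendsto_mul_rpow_comp hm hu (tendsto_atTop_mono hω' tendsto_id) hω
  simpa [integral_mul_const] using h1

lemma integrable_walk_one (hT : IsSamplingWalk T μ) {γ K : ℝ} (hγ : 2 < γ)
    (hS : ∀ j : ℕ, 1 ≤ j → μ.real {ω | T 1 ω = j} ≤ K * (j : ℝ) ^ (-γ)) :
    Integrable (fun ω => (T 1 ω : ℝ)) μ := by
  refine (hasSum_integral_comp (μ := μ) (hT.measurable 1) (a := fun j : ℕ => (j : ℝ)) ?_).1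
  refine Summable.of_nonneg_of_le (fun j => mul_nonneg (abs_nonneg _) measureReal_nonneg)
    (fun j => ?_) ((Real.summable_nat_rpow.2 (by linarith : 1 - γ < -1)).mul_left K)
  rw [Nat.abs_cast]
  rcases Nat.eq_zero_or_pos j with rfl | hj
  · simp [Real.zero_rpow (by linarith : 1 - γ ≠ 0)]
  · have hj0 : (0 : ℝ) < j := by exact_mod_cast hj
    calc (j : ℝ) * μ.real (T 1 ⁻¹' {j}) ≤ j * (K * (j : ℝ) ^ (-γ)) := by
          gcongr
          exact hS j hj
      _ = _ := by rw [sub_eq_add_neg, Real.rpow_add hj0, Real.rpow_one]; ring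

end Composition

/-! ### Negative moments under a power tail -/

section HeavyTails

variable {Ω : Type*} [MeasurableSpace Ω] {μ : Measure Ω} [IsProbabilityMeasure μ]
  {T : ℕ → Ω → ℕ} {u : ℕ → ℝ} {γ c K : ℝ}

lemma exists_bounds_of_isEquivalent {S : ℕ → ℝ} (hγ : 0 ≤ γ) (hc : 0 < c)
    (hS : S ~[atTop] fun j : ℕ => c * (j : ℝ) ^ (-γ)) :
    (∀ᶠ j : ℕ in atTop, c / 2 * (j : ℝ) ^ (-γ) ≤ S j) ∧
      ∃ K : ℝ, 0 ≤ K ∧ ∀ j : ℕ, 1 ≤ j → |S j| ≤ K * (j : ℝ) ^ (-γ) := by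
  have hne : ∀ᶠ j : ℕ in atTop, c * (j : ℝ) ^ (-γ) ≠ 0 := by
    filter_upwards [eventually_gt_atTop 0] with j hj
    have : (0 : ℝ) < j := by exact_mod_cast hj
    positivity
  have h1 := ((isEquivalent_iff_tendsto_one hne).1 hS).mul_const c
  rw [one_mul] at h1
  have h2 : Tendsto (fun j : ℕ => S j * (j : ℝ) ^ γ) atTop (𝓝 c) := by
    refine h1.congr fun j => ?_
    rw [Pi.div_apply, Real.rpow_neg (Nat.cast_nonneg j)]
    field_simp
  exact ⟨eventually_half_mul_rpow_le hc h2, exists_abs_le_rpow_neg_of_tendsto hγ h2⟩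

/-- Power lower bound for the negative moments of a walk whose steps have a power tail. -/
lemma exists_le_integral_walk_of_tail (hT : IsSamplingWalk T μ) {a b : ℝ} (ha0 : 0 < a)
    (ha1 : a < 1) (haγ : 1 + a ≤ γ) (hb0 : 0 < b) (hb1 : b ≤ 1) (hK : 0 ≤ K)
    (hS : ∀ j : ℕ, 1 ≤ j → μ.real {ω | T 1 ω = j} ≤ K * (j : ℝ) ^ (-γ)) :
    ∃ c : ℝ, 0 < c ∧ ∀ h : ℕ, 1 ≤ h → c * (h : ℝ) ^ (-b / a) ≤ ∫ ω, (T h ω : ℝ) ^ (-b) ∂μ := by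
  obtain ⟨C, hC, hφ⟩ := exists_one_sub_stepLaplace_le hT ha0 ha1 (K := K) fun j hj => by
    have hj1 : (1 : ℝ) ≤ j := by exact_mod_cast hj
    refine (hS j hj).trans ?_
    exact mul_le_mul_of_nonneg_left (Real.rpow_le_rpow_of_exponent_le hj1 (by linarith)) hK
  exact exists_le_integral_walk_rpow_neg hT ha0 hb0 hb1 hC hφ

/-- For `γ ≤ 2` the expected decay along the walk is at least `h ^ (-b / (γ - 1) - ε)`. -/
lemma eventually_rpow_le_integral_walk (hT : IsSamplingWalk T μ) {b : ℝ} (hγ1 : 1 < γ)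
    (hb0 : 0 < b) (hb1 : b ≤ 1) (hK : 0 ≤ K)
    (hS : ∀ j : ℕ, 1 ≤ j → μ.real {ω | T 1 ω = j} ≤ K * (j : ℝ) ^ (-γ)) (hγ2 : γ ≤ 2)
    {M ε : ℝ} (hε : 0 < ε) :
    ∀ᶠ h : ℕ in atTop, M * (h : ℝ) ^ (-b / (γ - 1) - ε) ≤ ∫ ω, (T h ω : ℝ) ^ (-b) ∂μ := by
  have hα : 0 < γ - 1 := by linarith
  -- The exponent `a = b/e` lies strictly below `γ - 1`, hence below `1` even at `γ = 2`, and yields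
  -- decay `h^(-e)`. The remaining `ε/2` absorbs the constants.
  set e : ℝ := b / (γ - 1) + ε / 2 with he
  have hq : 0 < b / (γ - 1) := by positivity
  have he0 : 0 < e := by positivity
  have hlt : b / e < γ - 1 := by
    rw [div_lt_iff₀ he0, he, mul_add, mul_div_cancel₀ _ hα.ne']
    have : 0 < (γ - 1) * (ε / 2) := by positivity
    linarith
  obtain ⟨c, hc, hcl⟩ := exists_le_integral_walk_of_tail hT (a := b / e) (by positivity)
    (by linarith) (by linarith) hb0 hb1 hK hS
  filter_upwards [eventually_le_mul_rpow_nat (M / c) (half_pos hε), eventually_ge_atTop 1]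
    with h h1 hh
  have hh0 : (0 : ℝ) < h := by exact_mod_cast hh
  refine le_trans ?_ (hcl h hh)
  have e1 : -b / (b / e) = (-b / (γ - 1) - ε) + ε / 2 := by
    rw [neg_div, div_div_cancel₀ hb0.ne', he]; ring
  rw [e1, Real.rpow_add hh0]
  rw [div_le_iff₀ hc] at h1
  calc M * (h : ℝ) ^ (-b / (γ - 1) - ε)
      ≤ ((h : ℝ) ^ (ε / 2) * c) * (h : ℝ) ^ (-b / (γ - 1) - ε) := by gcongr
    _ = _ := by ring

end HeavyTails

end RandomSampling

/-! ### Assembly of the regimes of `γ` -/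

theorem mainTheorem1 {Ω : Type*} [MeasurableSpace Ω] (μ : Measure Ω) [IsProbabilityMeasure μ]
    (p q : ℕ) (d : ℝ) (hd0 : 0 < d) (hd1 : d < 1 / 2)
    (X : ℕ → Ω → ℝ) (hXmeas : ∀ n, Measurable (X n))
    (hX : RandomSampling.IsFARIMA p d q X μ)
    (T : ℕ → Ω → ℕ) (hT : RandomSampling.IsSamplingWalk T μ)
    (hXT : IndepFun (fun ω n => X n ω) (fun ω n => T n ω) μ)
    (γ : ℝ) (hγ : 1 < γ) (c : ℝ) (hc : 0 < c)
    (hS : (fun j : ℕ => μ.real {ω | T 1 ω = j}) ~[atTop] fun j : ℕ => c * (j : ℝ) ^ (-γ)) :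
    RandomSampling.IsSecondOrderStationary (RandomSampling.sampled X T) μ ∧
    (2 < γ → ∃ C : ℝ, 0 < C ∧
      RandomSampling.autocov (RandomSampling.sampled X T) μ ~[atTop]
        fun h : ℕ => C * (h : ℝ) ^ (2 * d - 1)) ∧
    (γ ≤ 2 → ∃ C₁ C₂ : ℝ, 0 < C₁ ∧ 0 < C₂ ∧
      (∀ ε : ℝ, 0 < ε → ∀ᶠ h : ℕ in atTop,
        C₁ * (h : ℝ) ^ ((2 * d - 1) / (γ - 1) - ε) ≤
          RandomSampling.autocov (RandomSampling.sampled X T) μ h) ∧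
      (∀ h : ℕ, 1 ≤ h →
        RandomSampling.autocov (RandomSampling.sampled X T) μ h ≤
          C₂ * (h : ℝ) ^ ((2 * d - 1) / (γ - 1)))) ∧
    (RandomSampling.IsSecondOrderStationary X μ ∧ RandomSampling.HasLongMemory X μ ∧
      RandomSampling.HasMemoryParameter X μ d) ∧
    (2 ≤ γ →
      RandomSampling.HasLongMemory (RandomSampling.sampled X T) μ ∧
      RandomSampling.HasMemoryParameter (RandomSampling.sampled X T) μ d) ∧
    (2 * (1 - d) ≤ γ → γ < 2 →
      RandomSampling.HasLongMemory (RandomSampling.sampled X T) μ ∧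
      ∃ d' : ℝ, 0 ≤ d' ∧ d' < d ∧ d' = (1 - (1 - 2 * d) / (γ - 1)) / 2 ∧
        RandomSampling.HasMemoryParameter (RandomSampling.sampled X T) μ d') ∧
    (γ < 2 * (1 - d) →
      RandomSampling.HasShortMemory (RandomSampling.sampled X T) μ) := by
  obtain ⟨hstat, hmean, CX, hCX, hXlim⟩ := hX.secondOrder hd0 hd1 hXmeas
  obtain ⟨hYstat, hY⟩ := hstat.sampled hXmeas hmean hT hXT
  obtain ⟨hSl, K, hK0, hSu⟩ := RandomSampling.exists_bounds_of_isEquivalent (by linarith) hc hS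
  have hSu' : ∀ j : ℕ, 1 ≤ j → μ.real {ω | T 1 ω = j} ≤ K * (j : ℝ) ^ (-γ) := fun j hj =>
    (le_abs_self _).trans (hSu j hj)
  have hb : 0 < 1 - 2 * d := by linarith
  have hα : 0 < γ - 1 := by linarith
  obtain ⟨M, hM0, hM⟩ := RandomSampling.exists_abs_le_rpow_neg_of_tendsto hb.le hXlim
  have hXlow := RandomSampling.eventually_half_mul_rpow_le hCX hXlim
  have hYlow := RandomSampling.eventually_le_integral_comp_walk hT hb hM hXlow
  simp only [← hY] at hYlow
  have hexp : -(1 - 2 * d) / (γ - 1) = (2 * d - 1) / (γ - 1) := by rw [neg_sub]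
  have hlight : 2 < γ → ∃ C : ℝ, 0 < C ∧ Tendsto (fun h : ℕ =>
      RandomSampling.autocov (RandomSampling.sampled X T) μ h * (h : ℝ) ^ (1 - 2 * d))
        atTop (𝓝 C) := by
    intro hγ2
    simp only [hY]
    exact RandomSampling.exists_tendsto_integral_comp_walk hT hb hCX
      (RandomSampling.integrable_walk_one hT hγ2 hSu') hXlim
  have hupper : γ ≤ 2 → ∃ C : ℝ, 0 < C ∧ ∀ h : ℕ, 1 ≤ h →
      |RandomSampling.autocov (RandomSampling.sampled X T) μ h| ≤
        C * (h : ℝ) ^ ((2 * d - 1) / (γ - 1)) := by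
    intro hγ2
    obtain ⟨c', hc', hφ⟩ := RandomSampling.exists_stepLaplace_le hT hγ hγ2 (half_pos hc) hSl
    obtain ⟨C, hC, hCu⟩ := RandomSampling.exists_integral_walk_rpow_neg_le hT hα hb hc' hφ
    refine ⟨(M + 1) * C, by positivity, fun h hh => ?_⟩
    rw [hY, ← hexp]
    calc _ ≤ M * ∫ ω, (T h ω : ℝ) ^ (-(1 - 2 * d)) ∂μ :=
          RandomSampling.abs_integral_comp_walk_le hT hb hM hh
      _ ≤ M * (C * (h : ℝ) ^ (-(1 - 2 * d) / (γ - 1))) := by gcongr; exact hCu h hh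
      _ ≤ (M + 1) * (C * (h : ℝ) ^ (-(1 - 2 * d) / (γ - 1))) := by gcongr; linarith
      _ = _ := by ring
  -- The constant can be `1` for every `ε`, since `M` is arbitrary in the moment bound and may
  -- cancel `CX / 2`.
  have hlower : γ ≤ 2 → ∀ ε : ℝ, 0 < ε → ∀ᶠ h : ℕ in atTop,
      1 * (h : ℝ) ^ ((2 * d - 1) / (γ - 1) - ε) ≤
        RandomSampling.autocov (RandomSampling.sampled X T) μ h := by
    intro hγ2 ε hε
    filter_upwards [hYlow, RandomSampling.eventually_rpow_le_integral_walk hT hγ hb (by linarith)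
      hK0 hSu' hγ2 (M := (CX / 2)⁻¹) hε] with h h1 h2
    refine le_trans ?_ h1
    rw [hexp, inv_mul_le_iff₀ (half_pos hCX)] at h2
    rwa [one_mul]
  -- No `ε` is lost here, as `a = γ - 1 < 1` is admissible. This matters at `γ = 2(1 - d)`, where
  -- the exponent is exactly `-1` and any loss would spoil divergence.
  have hsharp : γ < 2 → ∃ c' : ℝ, 0 < c' ∧ ∀ᶠ h : ℕ in atTop,
      c' * (h : ℝ) ^ ((2 * d - 1) / (γ - 1)) ≤
        RandomSampling.autocov (RandomSampling.sampled X T) μ h := by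
    intro hγ2
    obtain ⟨c', hc', hl⟩ := RandomSampling.exists_le_integral_walk_of_tail hT hα (by linarith)
      (by linarith) hb (by linarith) hK0 hSu'
    refine ⟨CX / 2 * c', by positivity, ?_⟩
    filter_upwards [hYlow, eventually_ge_atTop 1] with h h1 hh
    have h2 := hl h hh
    rw [hexp] at h2
    refine le_trans ?_ h1
    rw [mul_assoc]
    gcongr
  refine ⟨hYstat, fun hγ2 => ?_, fun hγ2 => ?_,
    ⟨hstat, RandomSampling.longMemory_of_tendsto hd0 hd1 hCX hXlim⟩, fun hγ2 => ?_,
    fun hγ1 hγ2 => ?_, fun hγ1 => ?_⟩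
  · obtain ⟨C, hC, hlim⟩ := hlight hγ2
    refine ⟨C, hC, RandomSampling.isEquivalent_const_mul_rpow hC ?_⟩
    simpa only [neg_sub] using hlim
  · obtain ⟨C, hC, hu⟩ := hupper hγ2
    exact ⟨1, C, one_pos, hC, hlower hγ2, fun h hh => (le_abs_self _).trans (hu h hh)⟩
  · rcases hγ2.eq_or_lt with rfl | hγ2
    · obtain ⟨C, hC, hu⟩ := hupper le_rfl
      have hl := hlower le_rfl
      have e : (2 * d - 1) / ((2 : ℝ) - 1) = 2 * d - 1 := by norm_num
      rw [e] at hl hu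
      -- At `γ = 2` the choice `ε = d` leaves the exponent `d - 1 ≥ -1`, so the lossy bound still
      -- gives divergence.
      exact ⟨RandomSampling.hasLongMemory_of_le one_pos (by linarith) (hl d hd0),
        RandomSampling.hasMemoryParameter_of_bounds one_pos hl hu⟩
    · obtain ⟨C, hC, hlim⟩ := hlight hγ2
      exact RandomSampling.longMemory_of_tendsto hd0 hd1 hC hlim
  · obtain ⟨C, hC, hu⟩ := hupper hγ2.le
    have hl := hlower hγ2.le
    obtain ⟨c', hc', hs⟩ := hsharp hγ2
    have hq1 : (1 - 2 * d) / (γ - 1) ≤ 1 := by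
      rw [div_le_one hα]; linarith
    have hq2 : 1 - 2 * d < (1 - 2 * d) / (γ - 1) := by
      rw [lt_div_iff₀ hα]
      exact mul_lt_of_lt_one_right hb (by linarith)
    have hneg : (2 * d - 1) / (γ - 1) = -((1 - 2 * d) / (γ - 1)) := by rw [← neg_div, neg_sub]
    have he : (2 * d - 1) / (γ - 1) = 2 * ((1 - (1 - 2 * d) / (γ - 1)) / 2) - 1 := by
      rw [hneg]; ring
    refine ⟨RandomSampling.hasLongMemory_of_le hc' (by rw [hneg]; linarith) hs, _, ?_, ?_, rfl,
      ?_⟩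
    · linarith
    · linarith
    · rw [he] at hl hu
      exact RandomSampling.hasMemoryParameter_of_bounds one_pos hl hu
  · obtain ⟨C, hC, hu⟩ := hupper (by linarith)
    refine RandomSampling.hasShortMemory_of_le ?_ hu
    -- The exponent is below `-1` exactly when `γ - 1 < 1 - 2d`.
    rw [div_lt_iff₀ hα]
    linarith
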